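/- **Conventions.** Maps and morphisms are composed from left to right. Let $G$ be a group, $G^\circ=G\cup\{0\}$ the corresponding $0$-group, $I,L$ sets. An $L\times I$ matrix $P=(p_{\ell i})$ over $G^\circ$ is a *regular sandwich matrix* if none of its rows and columns consists entirely of zeros. Then $\mathscr M^\circ(G;I,L;P)=(I\times G\times L)\cup\{0\}$, with $(i,a,\ell)(j,b,k)=(i,ap_{\ell j}b,k)$ if $p_{\ell j}\neq0$ and all other products equal to $0$. *Unambiguous categories.* A category with subobjects is a small category $\mathcal C$ with a subcategory of *inclusions* on all objects that is a strict preorder, consists of monomorphisms of $\mathcal C$, and contains $\alpha$ whenever $\varphi=\alpha\psi$ with inclusions $\varphi,\psi$; write $a\subseteq b$ if there is an inclusion $\iota(a,b)\colon a\to b$. A *retraction* is a morphism $\theta$ with $\iota\theta=1$ for some inclusion $\iota$. A *normal cone* $\gamma$ with apex $c_\gamma$ is a family of morphisms $\gamma(a)\colon a\to c_\gamma$, one for each object $a$, with $\iota(a,b)\gamma(b)=\gamma(a)$ for $a\subseteq b$ and at least one $\gamma(a)$ an isomorphism. $\mathcal C$ is *unambiguous* if each inclusion $\iota$ has a unique $\theta$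 with $\iota\theta=1$, each morphism $f$ is uniquely a product of a retraction, an isomorphism and an inclusion (the product of the first two is denoted $f^\circ$), and for each object $c$ there is a normal cone $\mu$ with apex $c$ and $\mu(c)=1_c$. For a normal cone $\gamma$ and $f\colon c_\gamma\to d$ let $\gamma*f^\circ$ be the normal cone $a\mapsto\gamma(a)f^\circ$. The set $\widehat{\mathcal C}$ of normal cones carries the product $\gamma\cdot\delta=\gamma*(\delta(c_\gamma))^\circ$. For an idempotent cone $\mu$ the functor $H(\mu;-)\colon\mathcal C\to\mathbf{Set}$ has $H(\mu;c)=\{\mu*f^\circ: f\in\mathcal C(c_\mu,c)\}$ and $H(\mu;g)\colon\mu*f^\circ\mapsto\mu*(fg)^\circ$. The *dual* $\mathcal C^*$ is the full subcategory of $[\mathcal C,\mathbf{Set}]$ on these functors; its inclusions are the natural transformations whose components are inclusions of sets. Put $MH(\mu;-)=\{c:\mu(c)\text{ is an isomorphism}\}$. *Cross-connections.* A functor $F$ is a *local isomorphism* if it preserves inclusions, is fully faithful, and restricts for each object $c$ to an isomorphism of the full subcategory on $\{d: d\subseteq c\}$ onto the full subcategory on $\{e:e\subseteq F(c)\}$.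 A *cross-connection* $(\mathcal C,\mathcal D;\Gamma,\Delta)$ of unambiguous categories consists of local isomorphisms $\Gamma\colon\mathcal D\to\mathcal C^*$ and $\Delta\colon\mathcal C\to\mathcal D^*$ such that $c\in M\Gamma(d)\iff d\in M\Delta(c)$ for all objects $c,d$. If $c\in M\Gamma(d)$, let $\gamma(c,d)\in\widehat{\mathcal C}$ be the idempotent cone with apex $c$ and $H(\gamma(c,d);-)=\Gamma(d)$, and $\delta(c,d)\in\widehat{\mathcal D}$ the idempotent cone with apex $d$ and $H(\delta(c,d);-)=\Delta(c)$. If $c'\in M\Gamma(d)$ and $d'\in M\Delta(c)$, then $f^\dagger\colon d'\to d$ is a *transpose* of $f\colon c'\to c$ if $\Delta(f)$ sends $\delta(c',d)*h^\circ$ to $\delta(c,d')*(f^\dagger h)^\circ$ for all $h\colon d\to x$ in $\mathcal D$. The pairs $(\gamma(c',d)*f^\circ,\ \delta(c,d')*(f^\dagger)^\circ)$ are the *linked pairs*; they are the elements of the *cross-connection semigroup*, whose operation is $(\gamma,\delta)\circ(\gamma',\delta')=(\gamma\cdot\gamma',\delta'\cdot\delta)$. *Ideal categories.* For a semigroup $S$,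 $\mathbb L(S)$ has the objects $Se$ ($e=e^2\in S$), the morphisms $\rho(e,u,f)\colon Se\to Sf$, $x\mapsto xu$, with $u\in eSf$, and the inclusion maps as inclusions; $\mathbb R(S)$ is defined dually by the right ideals $eS$ and the maps $x\mapsto ux$, $u\in fSe$. A category with inclusions is *completely unambiguous* if it is isomorphic, by an isomorphism that preserves and reflects inclusions, to $\mathbb L(S)$ or $\mathbb R(S)$ for some Rees matrix semigroup $S$ over a group with a regular sandwich matrix. *The categories of a $0$-group.* Let $\mathcal C$ have the objects $L\cup\{0\}$ and $\mathcal D$ the objects $I\cup\{0\}$. Between nonzero objects, the hom-sets of $\mathcal C$ are $\{\rho_g:g\in G^\circ\}$ with $\rho_g\rho_h=\rho_{gh}$, those of $\mathcal D$ are $\{\lambda_g:g\in G^\circ\}$ with $\lambda_g\lambda_h=\lambda_{hg}$; between objects one of which is $0$ there is exactly one morphism, labelled by $0$. The inclusions are the identities and the morphisms from $0$. A normal cone of $\mathcal C$ [of $\mathcal D$] is given by its apex and the labels $(g_\alpha)_{\alpha\in L}$ [$(g_\alpha)_{\alpha\in I}$] of its components at the nonzero objects. For a regular sandwich matrix $P$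 with columns $p_i$ and rows $p_\ell$ let $p_0$ denote the zero column, respectively the zero row. The functors $\Gamma_P\colon\mathcal D\to\mathcal C^*$ and $\Delta_P\colon\mathcal C\to\mathcal D^*$ are described as follows: for $i\in I\cup\{0\}$, $\Gamma_P(i)$ is the $H$-functor whose value at $c$ consists of all normal cones with labels in $p_iG^\circ$ and apex $\subseteq c$, and $\Gamma_P(\lambda_g)$, for $\lambda_g\colon i\to j$, sends a cone with labels $p_ia$ to one with labels $p_jga$; for $\ell\in L\cup\{0\}$, $\Delta_P(\ell)$ is the $H$-functor whose value at $d$ consists of all normal cones with labels in $G^\circ p_\ell$ and apex $\subseteq d$, and $\Delta_P(\rho_g)$, for $\rho_g\colon \ell\to m$, sends a cone with labels $ap_\ell$ to one with labels $agp_m$. **Theorem.** Let $G$ be a group and $I,L$ sets. (1) Let $P$ be a regular $L\times I$ sandwich matrix over $G^\circ$ and $S=\mathscr M^\circ(G;I,L;P)$. Then $\mathbb L(S)$ and $\mathbb R(S)$ are unambiguous categories. There are isomorphisms $\mathcal C\cong\mathbb L(S)$ and $\mathcal D\cong\mathbb R(S)$ that preserve and reflect inclusions, under which the object $\ell\in L$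 corresponds to $(I\times G\times\{\ell\})\cup\{0\}$, the morphism $\rho_g\colon\ell\to k$ to the map $(i,a,\ell)\mapsto(i,ag,k)$, the object $i\in I$ to $(\{i\}\times G\times L)\cup\{0\}$, the morphism $\lambda_g\colon i\to j$ to the map $(i,a,\ell)\mapsto(j,ga,\ell)$ (where $(i,0,\ell)$ means $0$), and $0$ to $\{0\}$. With these identifications, there is exactly one cross-connection $(\mathbb L(S),\mathbb R(S);\Gamma_P,\Delta_P)$ with $\Gamma_P$ and $\Delta_P$ as described above. (2) Conversely, $\mathcal C$ and $\mathcal D$, which depend on $L$, $I$ and $G^\circ$ only, are unambiguous and completely unambiguous categories, and for every regular $L\times I$ sandwich matrix $P$ over $G^\circ$ there is exactly one cross-connection $(\mathcal C,\mathcal D;\Gamma_P,\Delta_P)$ with $\Gamma_P$ and $\Delta_P$ as described above; its linked pairs are closed under $\circ$, and its cross-connection semigroup is isomorphic to $\mathscr M^\circ(G;I,L;P)$. -/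

import Mathlib

open CategoryTheory MulOpposite

attribute [-instance] CategoryTheory.catToReflQuiver

universe u

/-! ## Categories with subobjects, normal cones, unambiguous categories

Composition `f ≫ g` is read from left to right. -/

/-- A small category with a distinguished class of morphisms, the *inclusions*. -/
class HasInclusions (C : Type u) [SmallCategory C] where
  IsIncl : ∀ {a b : C}, (a ⟶ b) → Prop

/-- `f` is an inclusion. -/
def IsIncl {C : Type u} [SmallCategory C] [HasInclusions C] {a b : C} (f : a ⟶ b) : Prop :=
  HasInclusions.IsIncl f

/-- `a ⊆ b`: there is an inclusion from `a` to `b`. -/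
def SubObj {C : Type u} [SmallCategory C] [HasInclusions C] (a b : C) : Prop :=
  ∃ f : a ⟶ b, IsIncl f

/-- The inclusions form a subcategory on all objects that is a strict preorder, they are
monomorphisms, and `φ = α ≫ ψ` with inclusions `φ`, `ψ` forces `α` to be an inclusion. -/
structure IsCategoryWithSubobjects (C : Type u) [SmallCategory C] [HasInclusions C] : Prop where
  id_incl : ∀ a : C, IsIncl (𝟙 a)
  comp_incl : ∀ {a b c : C} (f : a ⟶ b) (g : b ⟶ c), IsIncl f → IsIncl g → IsIncl (f ≫ g)
  thin : ∀ {a b : C} (f g : a ⟶ b), IsIncl f → IsIncl g → f = g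
  strict : ∀ {a b : C} (f : a ⟶ b) (g : b ⟶ a), IsIncl f → IsIncl g → a = b
  mono : ∀ {a b : C} (f : a ⟶ b), IsIncl f → Mono f
  cancel : ∀ {a b c : C} (φ : a ⟶ c) (ψ : b ⟶ c) (α : a ⟶ b),
    IsIncl φ → IsIncl ψ → φ = α ≫ ψ → IsIncl α

/-- A retraction is a right inverse `θ` of an inclusion `ι`, i.e. `ι ≫ θ = 𝟙`. -/
def IsRetraction {C : Type u} [SmallCategory C] [HasInclusions C] {a b : C} (θ : a ⟶ b) : Prop :=
  ∃ ι : b ⟶ a, IsIncl ι ∧ ι ≫ θ = 𝟙 b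

/-- A normal factorisation `f = θ ≫ σ ≫ ι`: a retraction, an isomorphism, an inclusion. -/
structure NormalFactorisation {C : Type u} [SmallCategory C] [HasInclusions C] {a b : C}
    (f : a ⟶ b) where
  coim : C
  im : C
  θ : a ⟶ coim
  σ : coim ⟶ im
  ι : im ⟶ b
  retraction : IsRetraction θ
  iso : IsIso σ
  incl : IsIncl ι
  fac : θ ≫ σ ≫ ι = f

/-- A normal cone. -/
structure NormalCone (C : Type u) [SmallCategory C] [HasInclusions C] where
  apex : C
  app : ∀ a : C, a ⟶ apex
  compat : ∀ {a b : C} (ι : a ⟶ b), IsIncl ι → ι ≫ app b = app a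
  exists_iso : ∃ c : C, IsIso (app c)

theorem NormalCone.app_heq {C : Type u} [SmallCategory C] [HasInclusions C] {γ δ : NormalCone C}
    (h : γ = δ) (c : C) : HEq (γ.app c) (δ.app c) := by subst h; rfl

/-- Unambiguous categories. -/
class IsUnambiguous (C : Type u) [SmallCategory C] [HasInclusions C] : Prop where
  subobjects : IsCategoryWithSubobjects C
  splits : ∀ {a b : C} (ι : a ⟶ b), IsIncl ι → ∃! θ : b ⟶ a, ι ≫ θ = 𝟙 a
  factorisation : ∀ {a b : C} (f : a ⟶ b), Nonempty (Unique (NormalFactorisation f))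
  cone : ∀ c : C, ∃ (μ : NormalCone C) (h : c = μ.apex), μ.app c = eqToHom h

section Unambiguous

variable {C : Type u} [SmallCategory C] [HasInclusions C] [IsUnambiguous C]

/-- The normal factorisation of a morphism. -/
noncomputable def normalFac {a b : C} (f : a ⟶ b) : NormalFactorisation f :=
  (IsUnambiguous.factorisation f).some.default

/-- The image of a morphism. -/
noncomputable abbrev image {a b : C} (f : a ⟶ b) : C := (normalFac f).im

/-- The epimorphic component `f°`. -/
noncomputable def epiPart {a b : C} (f : a ⟶ b) : a ⟶ image f :=
  (normalFac f).θ ≫ (normalFac f).σ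

/-- The inclusion of the image. -/
noncomputable def imageIncl {a b : C} (f : a ⟶ b) : image f ⟶ b := (normalFac f).ι

theorem imageIncl_isIncl {a b : C} (f : a ⟶ b) : IsIncl (imageIncl f) := (normalFac f).incl

theorem epiPart_imageIncl {a b : C} (f : a ⟶ b) : epiPart f ≫ imageIncl f = f := by
  exact (Category.assoc _ _ _).trans (normalFac f).fac

/-- If `γ` is a normal cone and `θ` is a retraction starting at its apex, then `γ(c) ≫ θ` is an
isomorphism for some `c`. -/
theorem NormalCone.exists_iso_comp (γ : NormalCone C) {d : C} (θ : γ.apex ⟶ d)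
    (hθ : IsRetraction θ) : ∃ c : C, IsIso (γ.app c ≫ θ) := by
  obtain ⟨c, hc⟩ := γ.exists_iso
  obtain ⟨j, -, hj⟩ := hθ
  obtain ⟨X, Y, θ', σ, ι, ⟨j', -, hj'⟩, hσ, hι, hm⟩ := normalFac (j ≫ inv (γ.app c))
  refine ⟨Y, ?_⟩
  have h1 : θ' ≫ σ ≫ γ.app Y ≫ θ = 𝟙 _ := by
    have : (θ' ≫ σ ≫ ι) ≫ γ.app c ≫ θ = 𝟙 _ := by
      rw [hm]; simpa using hj
    rw [← γ.compat ι hι]; simpa using this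
  have h2 : j' = σ ≫ γ.app Y ≫ θ := by
    calc j' = j' ≫ θ' ≫ σ ≫ γ.app Y ≫ θ := by rw [h1, Category.comp_id]
      _ = _ := by rw [← Category.assoc, hj', Category.id_comp]
  have h3 : γ.app Y ≫ θ = inv σ ≫ j' := by rw [h2, IsIso.inv_hom_id_assoc]
  have h4 : IsIso j' := ⟨⟨θ', hj', by rw [h2, h1]⟩⟩
  rw [h3]
  infer_instance

/-- The normal cone `γ ∗ f°`, for a morphism `f` starting at the apex of `γ`. -/
noncomputable def NormalCone.star (γ : NormalCone C) {d : C} (f : γ.apex ⟶ d) : NormalCone C where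
  apex := image f
  app c := γ.app c ≫ epiPart f
  compat ι hι := by rw [← Category.assoc, γ.compat ι hι]
  exists_iso := by
    obtain ⟨c, hc⟩ := γ.exists_iso_comp (normalFac f).θ (normalFac f).retraction
    have hσ := (normalFac f).iso
    refine ⟨c, ?_⟩
    have h : γ.app c ≫ epiPart f = (γ.app c ≫ (normalFac f).θ) ≫ (normalFac f).σ :=
      (Category.assoc _ _ _).symm
    rw [h]
    exact IsIso.comp_isIso

/-- The product of normal cones, `γ · δ = γ ∗ (δ(c_γ))°`. -/
noncomputable instance : Mul (NormalCone C) := ⟨fun γ δ => γ.star (δ.app γ.apex)⟩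

theorem NormalCone.mul_def (γ δ : NormalCone C) : γ * δ = γ.star (δ.app γ.apex) := rfl

/-- An idempotent cone is the identity at its apex. -/
theorem NormalCone.app_apex {μ : NormalCone C} (hμ : IsIdempotentElem μ) :
    μ.app μ.apex = 𝟙 μ.apex := by
  have h : μ.star (μ.app μ.apex) = μ := hμ
  obtain ⟨c, hc⟩ := μ.exists_iso
  have h1 : HEq (μ.app c ≫ epiPart (μ.app μ.apex)) (μ.app c) := NormalCone.app_heq h c
  have h2 : image (μ.app μ.apex) = μ.apex := congrArg NormalCone.apex h
  have key : ∀ (x : C) (e : μ.apex ⟶ x) (i : x ⟶ μ.apex), IsIncl i → x = μ.apex →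
      HEq (μ.app c ≫ e) (μ.app c) → e ≫ i = 𝟙 _ := by
    rintro x e i hi rfl he
    have he' : e = 𝟙 _ := by
      have := eq_of_heq he
      rw [← cancel_epi (μ.app c), this, Category.comp_id]
    have hi' : i = 𝟙 _ := IsUnambiguous.subobjects.thin _ _ hi (IsUnambiguous.subobjects.id_incl _)
    rw [he', hi', Category.comp_id]
  have := key _ _ (imageIncl (μ.app μ.apex)) (imageIncl_isIncl _) h2 h1
  rwa [epiPart_imageIncl] at this

/-- For an idempotent cone `μ`, the map `f ↦ μ ∗ f°` is injective on each hom-set. -/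
theorem NormalCone.star_injective {μ : NormalCone C} (hμ : IsIdempotentElem μ) {c : C}
    {f g : μ.apex ⟶ c} (h : μ.star f = μ.star g) : f = g := by
  have h1 : HEq (μ.app μ.apex ≫ epiPart f) (μ.app μ.apex ≫ epiPart g) :=
    NormalCone.app_heq h μ.apex
  rw [NormalCone.app_apex hμ, Category.id_comp, Category.id_comp] at h1
  have h2 : image f = image g := congrArg NormalCone.apex h
  have key : ∀ (x y : C) (e : μ.apex ⟶ x) (e' : μ.apex ⟶ y) (i : x ⟶ c) (i' : y ⟶ c),
      IsIncl i → IsIncl i' → x = y → HEq e e' → e ≫ i = e' ≫ i' := by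
    rintro x y e e' i i' hi hi' rfl he
    rw [eq_of_heq he, IsUnambiguous.subobjects.thin _ _ hi hi']
  have := key _ _ _ _ _ _ (imageIncl_isIncl f) (imageIncl_isIncl g) h2 h1
  rwa [epiPart_imageIncl, epiPart_imageIncl] at this

end Unambiguous

/-! ## The dual of an unambiguous category -/

/-- A set-valued functor whose values are sets of normal cones. -/
structure ConeSetFunctor (C : Type u) [SmallCategory C] [HasInclusions C] where
  obj : C → Set (NormalCone C)
  map : ∀ {c d : C}, (c ⟶ d) → obj c → obj d
  map_id : ∀ (c : C) (x : obj c), map (𝟙 c) x = x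
  map_comp : ∀ {c d e : C} (f : c ⟶ d) (g : d ⟶ e) (x : obj c), map (f ≫ g) x = map g (map f x)

/-- The underlying functor to the category of types. -/
def ConeSetFunctor.toFunctor {C : Type u} [SmallCategory C] [HasInclusions C]
    (F : ConeSetFunctor C) : C ⥤ Type u where
  obj c := F.obj c
  map f := TypeCat.ofHom (F.map f)
  map_id c := by ext x; exact congrArg _ (F.map_id c x)
  map_comp f g := by ext x; exact congrArg _ (F.map_comp f g x)

section Dual

variable {C : Type u} [SmallCategory C] [HasInclusions C] [IsUnambiguous C]

/-- The `H`-functor `H(μ;-)` of an idempotent cone `μ`: `H(μ;c) = {μ ∗ f° : f ∈ C(c_μ,c)}` and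
`H(μ;g)` sends `μ ∗ f°` to `μ ∗ (f ≫ g)°`, see `hFunctor_map`. -/
noncomputable def hFunctor (μ : NormalCone C) (hμ : IsIdempotentElem μ) : ConeSetFunctor C where
  obj c := {γ | ∃ f : μ.apex ⟶ c, μ.star f = γ}
  map g x := ⟨μ.star (x.2.choose ≫ g), _, rfl⟩
  map_id c x := by
    apply Subtype.ext
    simpa using x.2.choose_spec
  map_comp f g x := by
    apply Subtype.ext
    have h : ∃ f' : μ.apex ⟶ _, μ.star f' = μ.star (x.2.choose ≫ f) := ⟨_, rfl⟩
    have h' := NormalCone.star_injective hμ h.choose_spec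
    change μ.star _ = μ.star (h.choose ≫ g)
    rw [h', Category.assoc]

theorem hFunctor_map (μ : NormalCone C) (hμ : IsIdempotentElem μ) {c d : C} (f : μ.apex ⟶ c)
    (g : c ⟶ d) :
    (hFunctor μ hμ).map g ⟨μ.star f, f, rfl⟩ = ⟨μ.star (f ≫ g), f ≫ g, rfl⟩ := by
  apply Subtype.ext
  have h : ∃ f' : μ.apex ⟶ _, μ.star f' = μ.star f := ⟨_, rfl⟩
  have h' := NormalCone.star_injective hμ h.choose_spec
  change μ.star (h.choose ≫ g) = μ.star _
  rw [h']

variable (C) in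
/-- The dual `C*`: the full subcategory of `[C, Set]` on the `H`-functors. -/
structure Dual where
  functor : ConeSetFunctor C
  isH : ∃ (μ : NormalCone C) (hμ : IsIdempotentElem μ), functor = hFunctor μ hμ

/-- Morphisms of the dual are all natural transformations. -/
instance : SmallCategory (Dual C) where
  Hom F G := F.functor.toFunctor ⟶ G.functor.toFunctor
  id F := 𝟙 F.functor.toFunctor
  comp α β := NatTrans.vcomp α β

/-- The component at `c` of a morphism of the dual, as a map of sets. -/
def Dual.comp {F G : Dual C} (α : F ⟶ G) (c : C) (x : F.functor.obj c) : G.functor.obj c :=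
  (NatTrans.app α c) x

/-- Inclusions of the dual are the natural transformations all of whose components are
inclusions of sets. -/
instance : HasInclusions (Dual C) where
  IsIncl {F _} α := ∀ (c : C) (x : F.functor.obj c), (Dual.comp α c x).1 = x.1

/-- The `M`-set `MH(μ;-) = {c : μ(c) is an isomorphism}` of an `H`-functor. -/
def Dual.mSet (F : Dual C) : Set C :=
  {c | ∃ (μ : NormalCone C) (hμ : IsIdempotentElem μ), F.functor = hFunctor μ hμ ∧
    IsIso (μ.app c)}

end Dual

/-! ## Cross-connections -/

/-- Inclusion preserving isomorphisms of categories with subobjects. -/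
structure IsInclusionIso {C D : Type u} [SmallCategory C] [HasInclusions C] [SmallCategory D]
    [HasInclusions D] (F : C ⥤ D) : Prop where
  bijective : Function.Bijective F.obj
  full : F.Full
  faithful : F.Faithful
  incl_iff : ∀ {a b : C} (f : a ⟶ b), IsIncl (F.map f) ↔ IsIncl f

/-- Local isomorphisms. As `F` is fully faithful, its restriction to the ideal `(c)`, the full
subcategory of all `d ⊆ c`, is an isomorphism onto the ideal `(F c)` if and only if it is
bijective on objects. -/
structure IsLocalIso {C D : Type u} [SmallCategory C] [HasInclusions C] [SmallCategory D]
    [HasInclusions D] (F : C ⥤ D) : Prop where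
  incl : ∀ {a b : C} (f : a ⟶ b), IsIncl f → IsIncl (F.map f)
  full : F.Full
  faithful : F.Faithful
  ideal : ∀ c : C, Set.BijOn F.obj {d | SubObj d c} {e | SubObj e (F.obj c)}

/-- A cross-connection `(C, D; Γ, Δ)` of unambiguous categories. -/
structure CrossConnection (C D : Type u) [SmallCategory C] [HasInclusions C] [IsUnambiguous C]
    [SmallCategory D] [HasInclusions D] [IsUnambiguous D] where
  Γ : D ⥤ Dual C
  Δ : C ⥤ Dual D
  localIso_Γ : IsLocalIso Γ
  localIso_Δ : IsLocalIso Δ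
  mem_mSet : ∀ (c : C) (d : D), c ∈ (Γ.obj d).mSet ↔ d ∈ (Δ.obj c).mSet

namespace CrossConnection

variable {C D : Type u} [SmallCategory C] [HasInclusions C] [IsUnambiguous C]
  [SmallCategory D] [HasInclusions D] [IsUnambiguous D]

/-- `Ω.IsGammaCone c d μ`: `μ = γ(c,d)`, the idempotent cone of `C` with apex `c` and
`H(μ;-) = Γ(d)`. -/
def IsGammaCone (Ω : CrossConnection C D) (c : C) (d : D) (μ : NormalCone C) : Prop :=
  μ.apex = c ∧ ∃ hμ : IsIdempotentElem μ, hFunctor μ hμ = (Ω.Γ.obj d).functor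

/-- `Ω.IsDeltaCone c d ν`: `ν = δ(c,d)`, the idempotent cone of `D` with apex `d` and
`H(ν;-) = Δ(c)`. -/
def IsDeltaCone (Ω : CrossConnection C D) (c : C) (d : D) (ν : NormalCone D) : Prop :=
  ν.apex = d ∧ ∃ hν : IsIdempotentElem ν, hFunctor ν hν = (Ω.Δ.obj c).functor

/-- Let `c'`, `d` be the apices of `μ`, `κ` and `d'` the apex of `ν`, where `κ = δ(c',d)` and
`ν = δ(c,d')`. The morphism `g : d' ⟶ d` is the transpose of `f : c' ⟶ c` if
`Δ(f) ≫ η_ν = η_κ ≫ D(g,-)`, where `η_κ : H(κ;-) ⟶ D(d,-)` sends `κ ∗ h°` to `h`; evaluated at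
an element `κ ∗ h°` this says that `Δ(f)` sends `κ ∗ h°` to `ν ∗ (g ≫ h)°`. -/
def IsTranspose (Ω : CrossConnection C D) {c' c : C} (κ ν : NormalCone D) (f : c' ⟶ c)
    (g : ν.apex ⟶ κ.apex) : Prop :=
  ∀ (x : D) (h : κ.apex ⟶ x) (m : κ.star h ∈ (Ω.Δ.obj c').functor.obj x),
    (Dual.comp (Ω.Δ.map f) x ⟨κ.star h, m⟩).1 = ν.star (g ≫ h)

/-- `γ ∈ Γ(c,d)` and `δ ∈ Δ(c,d)` are linked by `χ(c,d)`: there are `c' ∈ MΓ(d)`, `d' ∈ MΔ(c)` and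
`f : c' ⟶ c` with transpose `f† : d' ⟶ d` such that
`γ = γ(c',d) ∗ f°` and `δ = δ(c,d') ∗ (f†)°`. -/
def Linked (Ω : CrossConnection C D) (γ : NormalCone C) (δ : NormalCone D) : Prop :=
  ∃ (c : C) (μ : NormalCone C) (κ ν : NormalCone D) (f : μ.apex ⟶ c) (g : ν.apex ⟶ κ.apex),
    μ.apex ∈ (Ω.Γ.obj κ.apex).mSet ∧ ν.apex ∈ (Ω.Δ.obj c).mSet ∧
    Ω.IsGammaCone μ.apex κ.apex μ ∧ Ω.IsDeltaCone μ.apex κ.apex κ ∧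
    Ω.IsDeltaCone c ν.apex ν ∧ Ω.IsTranspose κ ν f g ∧
    γ = μ.star f ∧ δ = ν.star g

/-- The set `𝕊Ω` of all linked pairs. The operation
`(γ, δ) ∘ (γ', δ') = (γ · γ', δ' · δ)` is that of the product with the opposite. -/
def linkedPairs (Ω : CrossConnection C D) : Set (NormalCone C × (NormalCone D)ᵐᵒᵖ) :=
  {p | Ω.Linked p.1 p.2.unop}

end CrossConnection

/-! ## The categories of principal one-sided ideals of a semigroup -/

/-- The objects `S e`, `e` idempotent, of `𝕃(S)`. -/
@[ext]
structure LeftIdeals (S : Type u) [Semigroup S] where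
  carrier : Set S
  principal : ∃ e : S, IsIdempotentElem e ∧ carrier = {x | ∃ s, x = s * e}

/-- The partial right translations `ρ(e,u,f) : S e → S f`, `x ↦ x u`, with `u ∈ e S f`. -/
@[ext]
structure LeftIdeals.Hom {S : Type u} [Semigroup S] (A B : LeftIdeals S) where
  toFun : A.carrier → B.carrier
  translation : ∃ e u f : S, IsIdempotentElem e ∧ IsIdempotentElem f ∧
    A.carrier = {x | ∃ s, x = s * e} ∧ B.carrier = {x | ∃ s, x = s * f} ∧
    (∃ s, u = e * s * f) ∧ ∀ x, (toFun x : S) = x * u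

/-- The category `𝕃(S)`. -/
instance LeftIdeals.category (S : Type u) [Semigroup S] : SmallCategory (LeftIdeals S) where
  Hom := LeftIdeals.Hom
  id A := ⟨fun x => x, by
    obtain ⟨e, he, hA⟩ := A.principal
    refine ⟨e, e, e, he, he, hA, hA, ⟨e, by rw [he.eq, he.eq]⟩, ?_⟩
    rintro ⟨x, hx⟩
    rw [hA] at hx
    obtain ⟨s, rfl⟩ := hx
    simp [mul_assoc, he.eq]⟩
  comp φ ψ := ⟨fun x => ψ.toFun (φ.toFun x), by
    obtain ⟨e, u, f, he, hf, hA, hB, ⟨s, rfl⟩, hu⟩ := φ.translation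
    obtain ⟨g, v, h, hg, hh, hB', hC, ⟨t, rfl⟩, hv⟩ := ψ.translation
    refine ⟨e, _, h, he, hh, hA, hC, ⟨s * f * (g * t), rfl⟩, fun x => ?_⟩
    rw [hv, hu]
    simp [mul_assoc]⟩

/-- The inclusions of `𝕃(S)` are the inclusion maps of ideals. -/
instance (S : Type u) [Semigroup S] : HasInclusions (LeftIdeals S) where
  IsIncl {A _} φ := ∀ x : A.carrier, ((LeftIdeals.Hom.toFun φ x : S)) = x

/-- The objects `e S`, `e` idempotent, of `ℝ(S)`. -/
@[ext]
structure RightIdeals (S : Type u) [Semigroup S] where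
  carrier : Set S
  principal : ∃ e : S, IsIdempotentElem e ∧ carrier = {x | ∃ s, x = e * s}

/-- The partial left translations `λ(e,u,f) : e S → f S`, `x ↦ u x`, with `u ∈ f S e`. -/
@[ext]
structure RightIdeals.Hom {S : Type u} [Semigroup S] (A B : RightIdeals S) where
  toFun : A.carrier → B.carrier
  translation : ∃ e u f : S, IsIdempotentElem e ∧ IsIdempotentElem f ∧
    A.carrier = {x | ∃ s, x = e * s} ∧ B.carrier = {x | ∃ s, x = f * s} ∧
    (∃ s, u = f * s * e) ∧ ∀ x, (toFun x : S) = u * x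

/-- The category `ℝ(S)`. -/
instance RightIdeals.category (S : Type u) [Semigroup S] : SmallCategory (RightIdeals S) where
  Hom := RightIdeals.Hom
  id A := ⟨fun x => x, by
    obtain ⟨e, he, hA⟩ := A.principal
    refine ⟨e, e, e, he, he, hA, hA, ⟨e, by rw [he.eq, he.eq]⟩, ?_⟩
    rintro ⟨x, hx⟩
    rw [hA] at hx
    obtain ⟨s, rfl⟩ := hx
    simp [← mul_assoc, he.eq]⟩
  comp φ ψ := ⟨fun x => ψ.toFun (φ.toFun x), by
    obtain ⟨e, u, f, he, hf, hA, hB, ⟨s, rfl⟩, hu⟩ := φ.translation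
    obtain ⟨g, v, h, hg, hh, hB', hC, ⟨t, rfl⟩, hv⟩ := ψ.translation
    refine ⟨e, _, h, he, hh, hA, hC, ⟨t * g * (f * s), rfl⟩, fun x => ?_⟩
    rw [hv, hu]
    simp [mul_assoc]⟩

/-- The inclusions of `ℝ(S)` are the inclusion maps of ideals. -/
instance (S : Type u) [Semigroup S] : HasInclusions (RightIdeals S) where
  IsIncl {A _} φ := ∀ x : A.carrier, ((RightIdeals.Hom.toFun φ x : S)) = x

/-! ## Rees matrix semigroups -/

/-- `P` is a regular sandwich matrix: no row and no column consists entirely of zeros. -/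
def IsRegularSandwich {G I L : Type u} (P : L → I → WithZero G) : Prop :=
  (∀ l, ∃ i, P l i ≠ 0) ∧ ∀ i, ∃ l, P l i ≠ 0

/-- The underlying set `(I × G × L) ∪ {0}` of `M°(G;I,L;P)`. -/
inductive Rees {G I L : Type u} (P : L → I → WithZero G) : Type u
  | zero : Rees P
  | mk (i : I) (a : G) (l : L) : Rees P

namespace Rees

variable {G I L : Type u}

/-- `(i,g,l)` for `g ∈ G°`, which is read as `0` if `g = 0`. -/
def mkZ (P : L → I → WithZero G) (i : I) (g : WithZero G) (l : L) : Rees P :=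
  WithZero.recZeroCoe Rees.zero (fun a => Rees.mk i a l) g

/-- `(i,a,l) (j,b,k)` is `(i, a p_{lj} b, k)` if `p_{lj} ≠ 0`, and `0` otherwise. -/
instance [Group G] (P : L → I → WithZero G) : Mul (Rees P) where
  mul
    | .mk i a l, .mk j b k => mkZ P i (a * P l j * b) k
    | _, _ => .zero

theorem zero_mul' [Group G] {P : L → I → WithZero G} (x : Rees P) : zero * x = zero := rfl

theorem mul_zero' [Group G] {P : L → I → WithZero G} (x : Rees P) : x * zero = zero := by
  cases x <;> rfl

theorem mk_mul_mk [Group G] {P : L → I → WithZero G} (i j : I) (a b : G) (l k : L) :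
    (mk i a l * mk j b k : Rees P) = mkZ P i (a * P l j * b) k := rfl

theorem mkZ_mul_mk [Group G] {P : L → I → WithZero G} (i j : I) (g : WithZero G) (b : G)
    (l k : L) : mkZ P i g l * mk j b k = mkZ P i (g * P l j * b) k := by
  cases g with
  | zero => simp [mkZ, zero_mul']
  | coe a => rfl

theorem mk_mul_mkZ [Group G] {P : L → I → WithZero G} (i j : I) (a : G) (g : WithZero G)
    (l k : L) : mk i a l * mkZ P j g k = mkZ P i (a * P l j * g) k := by
  cases g with
  | zero => simp [mkZ, mul_zero']
  | coe b => rfl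

instance [Group G] (P : L → I → WithZero G) : Semigroup (Rees P) where
  mul_assoc x y z := by
    cases x with
    | zero => rfl
    | mk i a l =>
      cases y with
      | zero => rfl
      | mk j b k =>
        cases z with
        | zero => simp only [mul_zero']
        | mk m c n => rw [mk_mul_mk, mk_mul_mk, mkZ_mul_mk, mk_mul_mkZ]; simp only [mul_assoc]

end Rees

/-! ## The categories with object set `X°` built from a `0`-group -/

/-- The object set `X° = X ∪ {0}`. -/
inductive CUCat (X Z : Type u) : Type u
  | zero : CUCat X Z
  | pt (x : X) : CUCat X Z

/-- Morphisms between two nonzero objects are labelled by the `0`-group `Z`, and there is exactly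
one morphism, with label `0`, between two objects one of which is `0`. Labels are multiplied. -/
instance (X Z : Type u) [GroupWithZero Z] : SmallCategory (CUCat X Z) where
  Hom c d := {g : Z // c = .zero ∨ d = .zero → g = 0}
  id c := match c with
    | .zero => ⟨0, fun _ => rfl⟩
    | .pt _ => ⟨1, by simp⟩
  comp f g := ⟨f.1 * g.1, by
    rintro (h | h)
    · rw [f.2 (Or.inl h), zero_mul]
    · rw [g.2 (Or.inr h), mul_zero]⟩
  id_comp {c d} f := by
    cases c
    · exact Subtype.ext (by simp [f.2 (Or.inl rfl)])
    · exact Subtype.ext (by simp)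
  comp_id {c d} f := by
    cases d
    · exact Subtype.ext (by simp [f.2 (Or.inr rfl)])
    · exact Subtype.ext (by simp)
  assoc f g h := Subtype.ext (mul_assoc _ _ _)

/-- The label of a morphism. -/
def CUCat.label {X Z : Type u} [GroupWithZero Z] {c d : CUCat X Z} (f : c ⟶ d) : Z := f.1

/-- The inclusions are the identities and the morphisms `0 ⟶ x`. -/
instance (X Z : Type u) [GroupWithZero Z] : HasInclusions (CUCat X Z) where
  IsIncl {c d} f := c = .zero ∨ ∃ h : c = d, f = eqToHom h

/-- `C`, with object set `L°` and hom-sets `G°` between nonzero objects. -/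
abbrev LeftCat (G L : Type u) [Group G] : Type u := CUCat L (WithZero G)

/-- `D`, with object set `I°` and hom-sets `(G°)ᵒᵖ` between nonzero objects. -/
abbrev RightCat (G I : Type u) [Group G] : Type u := CUCat I (WithZero G)ᵐᵒᵖ

/-- A *completely unambiguous* category is one that arises, up to an inclusion preserving
isomorphism, as `𝕃(S)` or `ℝ(S)` for a Rees matrix semigroup `S = M°(G;I,L;P)`. -/
def IsCompletelyUnambiguous (C : Type u) [SmallCategory C] [HasInclusions C] : Prop :=
  ∃ (G I L : Type u) (_ : Group G) (P : L → I → WithZero G), IsRegularSandwich P ∧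
    ((∃ F : C ⥤ LeftIdeals (Rees P), IsInclusionIso F) ∨
      ∃ F : C ⥤ RightIdeals (Rees P), IsInclusionIso F)

/-! ## The cross-connection of a sandwich matrix -/

section Sandwich

variable {G I L : Type u} [Group G] (P : L → I → WithZero G)

/-- The ideal `{0}`, respectively `{0} ∪ {(i,a,l) : i, a}`. -/
def leftIdeal : LeftCat G L → Set (Rees P)
  | .zero => {.zero}
  | .pt l => {x | x = .zero ∨ ∃ i a, x = .mk i a l}

/-- The ideal `{0}`, respectively `{0} ∪ {(i,a,l) : a, l}`. -/
def rightIdeal : RightCat G I → Set (Rees P)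
  | .zero => {.zero}
  | .pt i => {x | x = .zero ∨ ∃ a l, x = .mk i a l}

/-- `E` identifies the object `l` with the left ideal of all `(i,a,l)` and `0`, and the morphism
`l ⟶ k` with label `g` with the translation `(i,a,l) ↦ (i,ag,k)`. -/
def IsLeftCoordinates (E : LeftCat G L ⥤ LeftIdeals (Rees P)) : Prop :=
  (∀ c, (E.obj c).carrier = leftIdeal P c) ∧
  ∀ (l k : L) (f : (.pt l : LeftCat G L) ⟶ .pt k) (i : I) (a : G) (h),
    ((E.map f).toFun ⟨.mk i a l, h⟩ : Rees P) = Rees.mkZ P i (a * CUCat.label f) k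

/-- `E` identifies the object `i` with the right ideal of all `(i,a,l)` and `0`, and the morphism
`i ⟶ j` with label `g` with the translation `(i,a,l) ↦ (j,ga,l)`. -/
def IsRightCoordinates (E : RightCat G I ⥤ RightIdeals (Rees P)) : Prop :=
  (∀ d, (E.obj d).carrier = rightIdeal P d) ∧
  ∀ (i j : I) (f : (.pt i : RightCat G I) ⟶ .pt j) (a : G) (l : L) (h),
    ((E.map f).toFun ⟨.mk i a l, h⟩ : Rees P) = Rees.mkZ P j ((CUCat.label f).unop * a) l

/-- The column `p_i`, and the zero column for the object `0`. -/
def column : RightCat G I → L → WithZero G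
  | .zero, _ => 0
  | .pt i, l => P l i

/-- The row `p_l`, and the zero row for the object `0`. -/
def row : LeftCat G L → I → WithZero G
  | .zero, _ => 0
  | .pt l, i => P l i

/-- In a category `𝒞` identified with `CUCat X Z` by `E`, the normal cone `γ` is `((t_x)_x; k)`:
its apex is `k` and its component at each `x ∈ X` has label `t_x`. -/
def IsConeTuple {X Z : Type u} [GroupWithZero Z] {𝒞 : Type u} [SmallCategory 𝒞] [HasInclusions 𝒞]
    (E : CUCat X Z ⥤ 𝒞) (γ : NormalCone 𝒞) (t : X → Z) (k : CUCat X Z) : Prop :=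
  ∃ h : γ.apex = E.obj k, ∀ x : X, ∃ f : (.pt x : CUCat X Z) ⟶ k,
    CUCat.label f = t x ∧ γ.app (E.obj (.pt x)) ≫ eqToHom h = E.map f

/-- The cross-connection `(𝒞, 𝒟; Γ, Δ)`, where `𝒞` and `𝒟` are identified with `LeftCat G L` and
`RightCat G I` by `E` and `E'`, is `(𝒞, 𝒟; Γ_P, Δ_P)`:
* `Γ_P(i) = p_i G°` is the `H`-functor whose value at `c` consists of the normal cones
  `(p_i a; k)` with `a ∈ G°` and `k ⊆ c`, and `Γ_P(0)` consists of the zero cone;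
* `Γ_P(λ_g) = σ_g` for `λ_g : i ⟶ j`, where `σ_g` sends the cone of `p_i a` to that of `p_j g a`;
* `Δ_P(l) = G° p_l` is the `H`-functor whose value at `d` consists of the normal cones
  `(a p_l; k)` with `a ∈ G°` and `k ⊆ d`, and `Δ_P(0)` consists of the zero cone;
* `Δ_P(ρ_g) = τ_g` for `ρ_g : l ⟶ m`, where `τ_g` sends the cone of `a p_l` to that of `a g p_m`. -/
structure CrossConnection.IsOfSandwich {𝒞 𝒟 : Type u} [SmallCategory 𝒞] [HasInclusions 𝒞]
    [IsUnambiguous 𝒞] [SmallCategory 𝒟] [HasInclusions 𝒟] [IsUnambiguous 𝒟]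
    (E : LeftCat G L ⥤ 𝒞) (E' : RightCat G I ⥤ 𝒟) (Ω : CrossConnection 𝒞 𝒟) : Prop where
  Γ_obj : ∀ (i : RightCat G I) (c : LeftCat G L),
    (Ω.Γ.obj (E'.obj i)).functor.obj (E.obj c) =
      {γ | ∃ k, SubObj k c ∧ ∃ a : WithZero G, IsConeTuple E γ (fun l => column P i l * a) k}
  Γ_map : ∀ {i j : RightCat G I} (g : i ⟶ j) (c : LeftCat G L)
    (γ : (Ω.Γ.obj (E'.obj i)).functor.obj (E.obj c)) (a : WithZero G) (k : LeftCat G L),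
    IsConeTuple E γ.1 (fun l => column P i l * a) k →
    ∃ k', IsConeTuple E (Dual.comp (Ω.Γ.map (E'.map g)) (E.obj c) γ).1
      (fun l => column P j l * ((CUCat.label g).unop * a)) k'
  Δ_obj : ∀ (l : LeftCat G L) (d : RightCat G I),
    (Ω.Δ.obj (E.obj l)).functor.obj (E'.obj d) =
      {δ | ∃ k, SubObj k d ∧ ∃ a : WithZero G, IsConeTuple E' δ (fun i => op (a * row P l i)) k}
  Δ_map : ∀ {l m : LeftCat G L} (g : l ⟶ m) (d : RightCat G I)
    (δ : (Ω.Δ.obj (E.obj l)).functor.obj (E'.obj d)) (a : WithZero G) (k : RightCat G I),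
    IsConeTuple E' δ.1 (fun i => op (a * row P l i)) k →
    ∃ k', IsConeTuple E' (Dual.comp (Ω.Δ.map (E.map g)) (E'.obj d) δ).1
      (fun i => op (a * CUCat.label g * row P m i)) k'

end Sandwich

/-! ## Categories labelled by a group with zero -/

/-! In all the categories involved a morphism is determined by its ends and a label in a group with
zero, and labels multiply under composition. A morphism is an isomorphism iff its label is nonzero
or both ends are the zero object. A normal factorisation of a nonzero morphism is therefore
identity, morphism, identity, while a zero morphism factors through the zero object; this gives
unambiguity (`Labelling.isUnambiguous`). A normal cone is an arbitrary tuple of labels together with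
an apex, the apex being zero exactly when the tuple is, and `γ ∗ f°` multiplies the tuple on the
right by the label of `f`. An `H`-functor consequently consists of the cones whose tuples are right
multiples of one tuple (`mem_hFunctor`).

A regular matrix supplies one nonzero tuple for each column. Sending an object to the `H`-functor of
its column is a local isomorphism: a nonzero scalar is invertible, so an `H`-functor below a column
functor is either zero or everything, and a natural transformation is determined by its value on one
nonzero cone (`IsColumnFunctor.isLocalIso`). This is proved for two labelled categories with label
groups `Z`, `W` and an isomorphism `φ : W ≃* Zᵐᵒᵖ`, so that the statements on `Γ` and on `Δ` are
both instances, the second for the transposed matrix. The compatibility of `M`-sets reduces to `P l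
i ≠ 0` on both sides.

For the semigroup, `(i,a,l)` corresponds to the pair of cones with tuples `p_i a` and `a p_l` and
apices `l` and `i` (`Represents`). The product of cones evaluates `p_j b` at `l`, which yields the
factor `p_{lj}` of the Rees product. Solving the transpose equation shows that these pairs, with the
pair of zero cones, are exactly the linked pairs (`IsOfMatrix.mem_linkedPairs`).

Labellings are used in place of the concrete categories so that the argument applies at once to the
ideal categories of the Rees semigroup and to the categories built from the group;
`IsInclusionIso.labelling` produces the labelling in either case. -/

/-- A labelling of the objects of `A` by `X ∪ {0}` and of the morphisms of `A` by `Z`, which makes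
`A` a copy of `CUCat X Z`. -/
structure Labelling (X Z A : Type u) [GroupWithZero Z] [SmallCategory A] [HasInclusions A] where
  z : A
  p : X → A
  p_inj : Function.Injective p
  p_ne : ∀ x, p x ≠ z
  exhaust : ∀ a, a = z ∨ ∃ x, a = p x
  lab : ∀ {a b : A}, (a ⟶ b) → Z
  lab_inj : ∀ {a b : A} {f g : a ⟶ b}, lab f = lab g → f = g
  lab_surj : ∀ {a b : A} (g : Z), (a = z ∨ b = z → g = 0) → ∃ f : a ⟶ b, lab f = g
  lab_zero : ∀ {a b : A} (f : a ⟶ b), a = z ∨ b = z → lab f = 0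
  lab_comp : ∀ {a b c : A} (f : a ⟶ b) (g : b ⟶ c), lab (f ≫ g) = lab f * lab g
  lab_id : ∀ {a : A}, a ≠ z → lab (𝟙 a) = 1
  incl_iff : ∀ {a b : A} (f : a ⟶ b), IsIncl f ↔ a = z ∨ (a = b ∧ lab f = 1)

namespace Labelling

variable {X Z A : Type u} [GroupWithZero Z] [SmallCategory A] [HasInclusions A]
  (K : Labelling X Z A)

/-! ### Isomorphisms, subobjects and normal factorisations in terms of labels. -/

theorem ne_of_lab {a b : A} {f : a ⟶ b} (h : K.lab f ≠ 0) : a ≠ K.z ∧ b ≠ K.z :=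
  ⟨fun h' => h (K.lab_zero f (Or.inl h')), fun h' => h (K.lab_zero f (Or.inr h'))⟩

theorem lab_comp_eqToHom {a b c : A} (f : a ⟶ b) (h : b = c) :
    K.lab (f ≫ eqToHom h) = K.lab f := by
  subst h
  simp

/-- A nonzero label is invertible and its inverse labels the inverse morphism. An isomorphism with
label `0` would make an identity of a nonzero object have label `0` instead of `1`. -/
theorem isIso_iff {a b : A} (f : a ⟶ b) :
    IsIso f ↔ K.lab f ≠ 0 ∨ (a = K.z ∧ b = K.z) := by
  constructor
  · intro hf
    by_cases ha : a = K.z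
    · refine Or.inr ⟨ha, ?_⟩
      by_contra hb
      have h := K.lab_comp (inv f) f
      rw [IsIso.inv_hom_id, K.lab_id hb, K.lab_zero f (Or.inl ha), mul_zero] at h
      exact one_ne_zero h
    · left
      intro h0
      have h := K.lab_comp f (inv f)
      rw [IsIso.hom_inv_id, K.lab_id ha, h0, zero_mul] at h
      exact one_ne_zero h
  · rintro (h | ⟨rfl, rfl⟩)
    · obtain ⟨ha, hb⟩ := K.ne_of_lab h
      obtain ⟨g, hg⟩ := K.lab_surj (a := b) (b := a) (K.lab f)⁻¹
        (fun h' => absurd h' (by tauto))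
      exact ⟨g, K.lab_inj (by rw [K.lab_comp, hg, K.lab_id ha, mul_inv_cancel₀ h]),
        K.lab_inj (by rw [K.lab_comp, hg, K.lab_id hb, inv_mul_cancel₀ h])⟩
    · have : f = 𝟙 _ := K.lab_inj (by rw [K.lab_zero _ (Or.inl rfl), K.lab_zero _ (Or.inl rfl)])
      rw [this]
      infer_instance

theorem eq_id_of_lab {a : A} {f : a ⟶ a} (h : K.lab f = 1) : f = 𝟙 a := by
  have : K.lab f ≠ 0 := by rw [h]; exact one_ne_zero
  exact K.lab_inj (by rw [h, K.lab_id (K.ne_of_lab this).1])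

theorem isIncl_id (K : Labelling X Z A) (a : A) : IsIncl (𝟙 a) := by
  rw [K.incl_iff]
  by_cases h : a = K.z
  · exact Or.inl h
  · exact Or.inr ⟨rfl, K.lab_id h⟩

theorem subObj_iff {a b : A} : SubObj a b ↔ a = K.z ∨ a = b := by
  constructor
  · rintro ⟨f, hf⟩
    exact ((K.incl_iff f).1 hf).imp_right And.left
  · rintro (rfl | rfl)
    · obtain ⟨f, -⟩ := K.lab_surj (a := K.z) (b := b) 0 (fun _ => rfl)
      exact ⟨f, (K.incl_iff f).2 (Or.inl rfl)⟩
    · exact ⟨𝟙 a, K.isIncl_id a⟩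

theorem subObj_refl (K : Labelling X Z A) (a : A) : SubObj a a := ⟨𝟙 a, K.isIncl_id a⟩

theorem isCategoryWithSubobjects (K : Labelling X Z A) : IsCategoryWithSubobjects A where
  id_incl := K.isIncl_id
  comp_incl f g hf hg := by
    rw [K.incl_iff] at *
    rcases hf with h | ⟨rfl, hf⟩
    · exact Or.inl h
    · rcases hg with h | ⟨rfl, hg⟩
      · exact Or.inl h
      · exact Or.inr ⟨rfl, by rw [K.lab_comp, hf, hg, one_mul]⟩
  thin f g hf hg := by
    rw [K.incl_iff] at *
    apply K.lab_inj
    rcases hf with h | ⟨rfl, hf⟩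
    · rw [K.lab_zero f (Or.inl h), K.lab_zero g (Or.inl h)]
    · rcases hg with h | ⟨-, hg⟩
      · rw [K.lab_zero f (Or.inl h), K.lab_zero g (Or.inl h)]
      · rw [hf, hg]
  strict f g hf hg := by
    rw [K.incl_iff] at *
    rcases hf with h | ⟨h, -⟩
    · rcases hg with h' | ⟨h', -⟩
      · rw [h, h']
      · exact h'.symm
    · exact h
  mono f hf := by
    rw [K.incl_iff] at hf
    constructor
    intro c g h hgh
    apply K.lab_inj
    rcases hf with h' | ⟨-, hf⟩
    · rw [K.lab_zero g (Or.inr h'), K.lab_zero h (Or.inr h')]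
    · have := congrArg K.lab hgh
      rwa [K.lab_comp, K.lab_comp, hf, mul_one, mul_one] at this
  cancel := by
    rintro a b c φ ψ α hφ hψ rfl
    rw [K.incl_iff] at *
    rcases hφ with h | ⟨rfl, h1⟩
    · exact Or.inl h
    · rcases hψ with h | ⟨rfl, h2⟩
      · rw [K.lab_comp, K.lab_zero ψ (Or.inl h), mul_zero] at h1
        exact absurd h1.symm one_ne_zero
      · rw [K.lab_comp, h2, mul_one] at h1
        exact Or.inr ⟨rfl, h1⟩

theorem retraction_cases {a b : A} {θ : a ⟶ b} (h : IsRetraction θ) :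
    b = K.z ∨ (b = a ∧ K.lab θ = 1) := by
  obtain ⟨ι, hι, h⟩ := h
  rcases (K.incl_iff ι).1 hι with h' | ⟨rfl, h'⟩
  · exact Or.inl h'
  · rw [K.eq_id_of_lab h', Category.id_comp] at h
    by_cases hb : b = K.z
    · exact Or.inl hb
    · exact Or.inr ⟨rfl, by rw [h, K.lab_id hb]⟩

/-- A retraction onto, or an inclusion of, a nonzero object has label `1` and equal ends. If the
isomorphism in the middle has nonzero label, it thus carries the whole label of `f`; otherwise
everything passes through the zero object. Uniqueness of factorisations follows, all the data being
forced. -/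
theorem factorisation_cases {a b : A} {f : a ⟶ b} (N : NormalFactorisation f) :
    (K.lab f = 0 ∧ N.coim = K.z ∧ N.im = K.z) ∨
      (K.lab f ≠ 0 ∧ N.coim = a ∧ N.im = b ∧ K.lab N.θ = 1 ∧ K.lab N.σ = K.lab f ∧
        K.lab N.ι = 1) := by
  obtain ⟨c, i, θ, σ, ι, hθ, hσ, hι, hf⟩ := N
  have hf := congrArg K.lab hf
  rw [K.lab_comp, K.lab_comp] at hf
  rw [K.isIso_iff] at hσ
  rw [K.incl_iff] at hι
  rcases hσ with hσ | ⟨rfl, rfl⟩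
  · obtain ⟨h1, h2⟩ := K.ne_of_lab hσ
    rcases K.retraction_cases hθ with h | ⟨rfl, h⟩
    · exact absurd h h1
    rcases hι with h' | ⟨rfl, h'⟩
    · exact absurd h' h2
    rw [h, h', one_mul, mul_one] at hf
    exact Or.inr ⟨hf ▸ hσ, rfl, rfl, h, hf, h'⟩
  · rw [K.lab_zero θ (Or.inr rfl), zero_mul] at hf
    exact Or.inl ⟨hf.symm, rfl, rfl⟩

theorem factorisation_ext {a b : A} {f : a ⟶ b} {N N' : NormalFactorisation f}
    (h1 : N.coim = N'.coim) (h2 : N.im = N'.im) (h3 : K.lab N.θ = K.lab N'.θ)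
    (h4 : K.lab N.σ = K.lab N'.σ) (h5 : K.lab N.ι = K.lab N'.ι) : N = N' := by
  obtain ⟨c, i, θ, σ, ι, _, _, _, _⟩ := N
  obtain ⟨c', i', θ', σ', ι', _, _, _, _⟩ := N'
  dsimp only at h1 h2
  subst h1 h2
  obtain rfl := K.lab_inj h3
  obtain rfl := K.lab_inj h4
  obtain rfl := K.lab_inj h5
  rfl

theorem factorisation_subsingleton (K : Labelling X Z A) {a b : A} {f : a ⟶ b}
    (N N' : NormalFactorisation f) :
    N = N' := by
  rcases K.factorisation_cases N with ⟨h0, h1, h2⟩ | ⟨h0, h1, h2, h3, h4, h5⟩ <;>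
  rcases K.factorisation_cases N' with ⟨h0', h1', h2'⟩ | ⟨h0', h1', h2', h3', h4', h5'⟩
  · exact K.factorisation_ext (h1.trans h1'.symm) (h2.trans h2'.symm)
      (by rw [K.lab_zero _ (Or.inr h1), K.lab_zero _ (Or.inr h1')])
      (by rw [K.lab_zero _ (Or.inr h2), K.lab_zero _ (Or.inr h2')])
      (by rw [K.lab_zero _ (Or.inl h2), K.lab_zero _ (Or.inl h2')])
  · exact absurd h0 h0'
  · exact absurd h0' h0
  · exact K.factorisation_ext (h1.trans h1'.symm) (h2.trans h2'.symm) (h3.trans h3'.symm)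
      (h4.trans h4'.symm) (h5.trans h5'.symm)

theorem exists_factorisation (K : Labelling X Z A) {a b : A} (f : a ⟶ b) :
    Nonempty (NormalFactorisation f) := by
  by_cases hf : K.lab f = 0
  · obtain ⟨θ, -⟩ := K.lab_surj (a := a) (b := K.z) 0 (fun _ => rfl)
    obtain ⟨κ, -⟩ := K.lab_surj (a := K.z) (b := a) 0 (fun _ => rfl)
    obtain ⟨ι, -⟩ := K.lab_surj (a := K.z) (b := b) 0 (fun _ => rfl)
    refine ⟨⟨K.z, K.z, θ, 𝟙 _, ι, ⟨κ, (K.incl_iff κ).2 (Or.inl rfl), K.lab_inj ?_⟩,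
      inferInstance, (K.incl_iff ι).2 (Or.inl rfl), K.lab_inj ?_⟩⟩
    · rw [K.lab_zero _ (Or.inl rfl), K.lab_zero _ (Or.inl rfl)]
    · rw [K.lab_comp, K.lab_zero θ (Or.inr rfl), zero_mul, hf]
  · exact ⟨⟨a, b, 𝟙 a, f, 𝟙 b, ⟨𝟙 a, K.isIncl_id a, Category.comp_id _⟩,
      (K.isIso_iff f).2 (Or.inl hf), K.isIncl_id b, by simp⟩⟩

/-! ### Normal cones -/

/-- The labels of the components of a normal cone at the nonzero objects. -/
def tup (γ : NormalCone A) (x : X) : Z := K.lab (γ.app (K.p x))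

theorem lab_app_congr (γ : NormalCone A) {a b : A} (h : a = b) :
    K.lab (γ.app a) = K.lab (γ.app b) := by
  rw [h]

/-- A component that is an isomorphism either has nonzero label or has the zero object as target.
The labels alone therefore decide whether the apex is zero. -/
theorem apex_eq_iff (γ : NormalCone A) : γ.apex = K.z ↔ ∀ x, K.tup γ x = 0 := by
  constructor
  · exact fun h x => K.lab_zero _ (Or.inr h)
  · intro h
    obtain ⟨c, hc⟩ := γ.exists_iso
    rcases (K.isIso_iff _).1 hc with h' | ⟨-, h'⟩
    · rcases K.exhaust c with rfl | ⟨x, rfl⟩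
      · exact absurd (K.lab_zero _ (Or.inl rfl)) h'
      · exact absurd (h x) h'
    · exact h'

theorem cone_ext {γ δ : NormalCone A} (h : γ.apex = δ.apex) (ht : ∀ x, K.tup γ x = K.tup δ x) :
    γ = δ := by
  obtain ⟨c, f, _, _⟩ := γ
  obtain ⟨d, g, _, _⟩ := δ
  dsimp only at h
  subst h
  have : f = g := by
    funext a
    apply K.lab_inj
    rcases K.exhaust a with rfl | ⟨x, rfl⟩
    · rw [K.lab_zero _ (Or.inl rfl), K.lab_zero _ (Or.inl rfl)]
    · exact ht x
  subst this
  rfl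

/-- Two normal cones with apices below `c` are equal if they have the same labels. -/
theorem cone_ext_of_subObj {γ δ : NormalCone A} {c : A} (hγ : SubObj γ.apex c)
    (hδ : SubObj δ.apex c) (ht : ∀ x, K.tup γ x = K.tup δ x) : γ = δ := by
  refine K.cone_ext ?_ ht
  rw [K.subObj_iff] at hγ hδ
  have h : γ.apex = K.z ↔ δ.apex = K.z := by
    rw [K.apex_eq_iff, K.apex_eq_iff]
    simp only [ht]
  rcases hγ with h1 | h1 <;> rcases hδ with h2 | h2
  · rw [h1, h2]
  · rw [h1, h.1 h1]
  · rw [h2, h.2 h2]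
  · rw [h1, h2]

/-- Compatibility with inclusions is automatic, since an inclusion is an identity or starts at the
zero object; the only constraint is the relation between zero apex and zero tuple. -/
theorem exists_cone (t : X → Z) (k : A) (h : k = K.z ↔ ∀ x, t x = 0) :
    ∃ γ : NormalCone A, γ.apex = k ∧ ∀ x, K.tup γ x = t x := by
  -- Stating the label condition for every `x` with `a = K.p x` lets the components be chosen
  -- uniformly over all objects.
  have H : ∀ a : A, ∃ f : a ⟶ k, ∀ x, a = K.p x → K.lab f = t x := by
    intro a
    rcases K.exhaust a with rfl | ⟨x, rfl⟩
    · obtain ⟨f, -⟩ := K.lab_surj (a := K.z) (b := k) 0 (fun _ => rfl)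
      exact ⟨f, fun x hx => absurd hx.symm (K.p_ne x)⟩
    · obtain ⟨f, hf⟩ := K.lab_surj (a := K.p x) (b := k) (t x)
        (fun h' => h.1 (h'.resolve_left (K.p_ne x)) x)
      exact ⟨f, fun y hy => by rw [hf, K.p_inj hy]⟩
  choose f hf using H
  refine ⟨⟨k, f, fun {a b} ι hι => ?_, ?_⟩, rfl, fun x => hf _ x rfl⟩
  · rcases (K.incl_iff ι).1 hι with h' | ⟨rfl, h'⟩
    · exact K.lab_inj (by rw [K.lab_zero _ (Or.inl h'), K.lab_zero _ (Or.inl h')])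
    · rw [K.eq_id_of_lab h', Category.id_comp]
  · by_cases hk : k = K.z
    · exact ⟨K.z, (K.isIso_iff _).2 (Or.inr ⟨rfl, hk⟩)⟩
    · obtain ⟨x, hx⟩ := not_forall.1 (mt h.2 hk)
      exact ⟨K.p x, (K.isIso_iff _).2 (Or.inl (by rwa [hf _ x rfl]))⟩

theorem exists_zero_cone : ∃ γ : NormalCone A, γ.apex = K.z ∧ ∀ x, K.tup γ x = 0 :=
  K.exists_cone (fun _ => 0) K.z (by simp)

theorem isUnambiguous (K : Labelling X Z A) : IsUnambiguous A where
  subobjects := K.isCategoryWithSubobjects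
  splits {a b} ι hι := by
    rcases (K.incl_iff ι).1 hι with h | ⟨rfl, h⟩
    · obtain ⟨θ, -⟩ := K.lab_surj (a := b) (b := a) 0 (fun _ => rfl)
      exact ⟨θ, K.lab_inj (by rw [K.lab_zero _ (Or.inl h), K.lab_zero _ (Or.inl h)]),
        fun θ' _ => K.lab_inj (by rw [K.lab_zero _ (Or.inr h), K.lab_zero _ (Or.inr h)])⟩
    · rw [K.eq_id_of_lab h]
      exact ⟨𝟙 _, Category.comp_id _, fun θ' hθ' => by simpa using hθ'⟩
  factorisation f := by
    obtain ⟨N⟩ := K.exists_factorisation f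
    exact ⟨⟨⟨N⟩, fun N' => K.factorisation_subsingleton N' N⟩⟩
  cone c := by
    rcases K.exhaust c with rfl | ⟨x, rfl⟩
    · obtain ⟨γ, h, -⟩ := K.exists_zero_cone
      exact ⟨γ, h.symm, K.lab_inj (by rw [K.lab_zero _ (Or.inl rfl), K.lab_zero _ (Or.inl rfl)])⟩
    -- With the constant tuple `1` the component at the apex is the identity.
    · obtain ⟨γ, h, ht⟩ := K.exists_cone (fun _ => 1) (K.p x)
        ⟨fun h => absurd h (K.p_ne x), fun h => absurd (h x) one_ne_zero⟩
      refine ⟨γ, h.symm, K.lab_inj ?_⟩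
      rw [← Category.id_comp (eqToHom h.symm), K.lab_comp_eqToHom, K.lab_id (K.p_ne x)]
      exact ht x

/-! ### Products of cones, idempotent cones and `H`-functors in terms of labels. -/

variable [IsUnambiguous A]

/-- The inclusion of the image has label `1`, unless the image is zero, and then both labels vanish.
-/
theorem lab_epiPart {a b : A} (f : a ⟶ b) : K.lab (epiPart f) = K.lab f := by
  have h := congrArg K.lab (epiPart_imageIncl f)
  rw [K.lab_comp] at h
  rcases (K.incl_iff _).1 (imageIncl_isIncl f) with h' | ⟨-, h'⟩
  · rw [← h, K.lab_zero _ (Or.inr h'), zero_mul]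
  · rw [← h, h', mul_one]

theorem tup_star (γ : NormalCone A) {d : A} (f : γ.apex ⟶ d) (x : X) :
    K.tup (γ.star f) x = K.tup γ x * K.lab f := by
  rw [← K.lab_epiPart f]
  exact K.lab_comp _ _

theorem subObj_star (γ : NormalCone A) {d : A} (f : γ.apex ⟶ d) : SubObj (γ.star f).apex d :=
  ⟨imageIncl f, imageIncl_isIncl f⟩

theorem tup_mul (γ δ : NormalCone A) (x : X) :
    K.tup (γ * δ) x = K.tup γ x * K.lab (δ.app γ.apex) :=
  K.tup_star γ _ x

theorem subObj_mul (γ δ : NormalCone A) : SubObj (γ * δ).apex δ.apex :=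
  subObj_star γ _

theorem isIdempotentElem_of_lab {μ : NormalCone A} (h : μ.apex ≠ K.z → K.lab (μ.app μ.apex) = 1) :
    IsIdempotentElem μ := by
  refine K.cone_ext_of_subObj (subObj_mul μ μ) (K.subObj_refl _) fun x => ?_
  rw [K.tup_mul]
  by_cases h' : μ.apex = K.z
  · rw [(K.apex_eq_iff μ).1 h', zero_mul]
  · rw [h h', mul_one]

theorem isIdempotentElem_of_apex {μ : NormalCone A} (h : μ.apex = K.z) : IsIdempotentElem μ :=
  K.isIdempotentElem_of_lab fun h' => absurd h h'

theorem isIdempotentElem_of_tup {μ : NormalCone A} {x : X} (h : μ.apex = K.p x)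
    (ht : K.tup μ x = 1) : IsIdempotentElem μ :=
  K.isIdempotentElem_of_lab fun _ => (K.lab_app_congr μ h).trans ht

theorem tup_apex {μ : NormalCone A} {x : X} (h : μ.apex = K.p x) (hμ : IsIdempotentElem μ) :
    K.tup μ x = 1 := by
  have h' := congrArg K.lab (NormalCone.app_apex hμ)
  rw [K.lab_id (by rw [h]; exact K.p_ne x), K.lab_app_congr μ h] at h'
  exact h'

/-- Only the realisation of the scalar `g` by a morphism needs care. If `γ` has zero apex, the zero
morphism replaces `g`; otherwise `c` is the apex of `γ`, the apex of `μ` is nonzero too, and every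
label is available. -/
theorem mem_hFunctor {μ : NormalCone A} {hμ : IsIdempotentElem μ} {c : A} {γ : NormalCone A} :
    γ ∈ (hFunctor μ hμ).obj c ↔
      SubObj γ.apex c ∧ ∃ g : Z, ∀ x, K.tup γ x = K.tup μ x * g := by
  constructor
  · rintro ⟨f, rfl⟩
    exact ⟨subObj_star μ f, K.lab f, K.tup_star μ f⟩
  · rintro ⟨h, g, hg⟩
    suffices ∃ f : μ.apex ⟶ c, ∀ x, K.tup γ x = K.tup μ x * K.lab f by
      obtain ⟨f, hf⟩ := this
      exact ⟨f, K.cone_ext_of_subObj (subObj_star μ f) h fun x => by rw [K.tup_star, hf]⟩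
    by_cases hz : γ.apex = K.z
    · obtain ⟨f, hf⟩ := K.lab_surj (a := μ.apex) (b := c) 0 (fun _ => rfl)
      exact ⟨f, fun x => by rw [hf, mul_zero, (K.apex_eq_iff γ).1 hz]⟩
    · obtain rfl := ((K.subObj_iff).1 h).resolve_left hz
      have hμz : μ.apex ≠ K.z := fun h' => hz ((K.apex_eq_iff γ).2 fun x => by
        rw [hg, (K.apex_eq_iff μ).1 h', zero_mul])
      obtain ⟨f, hf⟩ := K.lab_surj (a := μ.apex) (b := γ.apex) g
        (fun h' => absurd h' (by tauto))
      exact ⟨f, fun x => by rw [hf, hg]⟩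

theorem self_mem_hFunctor (K : Labelling X Z A) (μ : NormalCone A) (hμ : IsIdempotentElem μ) :
    μ ∈ (hFunctor μ hμ).obj μ.apex :=
  K.mem_hFunctor.2 ⟨K.subObj_refl _, 1, fun _ => (mul_one _).symm⟩

end Labelling

/-! ## Functors into the dual of a labelled category -/

section DualBasics

variable {A : Type u} [SmallCategory A] [HasInclusions A] [IsUnambiguous A]

theorem Dual.ext {F F' : Dual A} (h : F.functor = F'.functor) : F = F' := by
  cases F
  cases F'
  congr

theorem Dual.hom_ext {F F' : Dual A} {α β : F ⟶ F'}
    (h : ∀ c x, (Dual.comp α c x).1 = (Dual.comp β c x).1) : α = β := by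
  apply NatTrans.ext
  funext c
  ext x
  exact Subtype.ext (h c x)

theorem Dual.hom_heq {F F' G G' : Dual A} {α : F ⟶ F'} {β : G ⟶ G'} (h : F = G) (h' : F' = G')
    (H : ∀ c x y, x.1 = y.1 → (Dual.comp α c x).1 = (Dual.comp β c y).1) : HEq α β := by
  subst h h'
  exact heq_of_eq (Dual.hom_ext fun c x => H c x x rfl)

theorem Dual.naturality {F F' : Dual A} (α : F ⟶ F') {c d : A} (f : c ⟶ d)
    (x : F.functor.obj c) :
    Dual.comp α d (F.functor.map f x) = F'.functor.map f (Dual.comp α c x) :=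
  congrArg (fun k => k.hom x) (NatTrans.naturality α f)

theorem Dual.comp_comp {F F' F'' : Dual A} (α : F ⟶ F') (β : F' ⟶ F'') (c : A)
    (x : F.functor.obj c) : Dual.comp (α ≫ β) c x = Dual.comp β c (Dual.comp α c x) := rfl

theorem Dual.comp_id (F : Dual A) (c : A) (x : F.functor.obj c) : Dual.comp (𝟙 F) c x = x := rfl

/-- A morphism of the dual, given by its components. -/
def Dual.mkHom {F F' : Dual A} (m : ∀ c, F.functor.obj c → F'.functor.obj c)
    (h : ∀ {c d : A} (f : c ⟶ d) (x : F.functor.obj c),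
      m d (F.functor.map f x) = F'.functor.map f (m c x)) : F ⟶ F' :=
  ({ app := fun c => TypeCat.ofHom (m c)
     naturality := fun c d f => by
      ext x
      exact h f x } : F.functor.toFunctor ⟶ F'.functor.toFunctor)

theorem Dual.comp_mkHom {F F' : Dual A} (m : ∀ c, F.functor.obj c → F'.functor.obj c) (h)
    (c : A) (x : F.functor.obj c) : Dual.comp (Dual.mkHom (F := F) (F' := F') m h) c x = m c x :=
  rfl

end DualBasics

namespace Labelling

section Dual

variable {X Z A : Type u} [GroupWithZero Z] [SmallCategory A] [HasInclusions A]
  (K : Labelling X Z A) [IsUnambiguous A]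

theorem subObj_of_mem {F : Dual A} {c : A} {γ : NormalCone A} (h : γ ∈ F.functor.obj c) :
    SubObj γ.apex c := by
  obtain ⟨F, μ, hμ, rfl⟩ := F
  obtain ⟨f, rfl⟩ := h
  exact subObj_star μ f

theorem tup_map {F : Dual A} {c d : A} (g : c ⟶ d) (γ : F.functor.obj c) (x : X) :
    K.tup (F.functor.map g γ).1 x = K.tup γ.1 x * K.lab g := by
  obtain ⟨F, μ, hμ, rfl⟩ := F
  obtain ⟨γ, f, rfl⟩ := γ
  dsimp only
  rw [hFunctor_map]
  dsimp only
  rw [K.tup_star, K.tup_star, K.lab_comp, mul_assoc]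

theorem mem_ext {F F' : Dual A} {c : A} {γ : F.functor.obj c} {δ : F'.functor.obj c}
    (h : ∀ x, K.tup γ.1 x = K.tup δ.1 x) : γ.1 = δ.1 :=
  K.cone_ext_of_subObj (subObj_of_mem γ.2) (subObj_of_mem δ.2) h

/-- The action of an `H`-functor on morphisms is right multiplication of tuples, whichever cone
represents it, so its values on objects determine it. -/
theorem dual_ext (K : Labelling X Z A) {F F' : Dual A}
    (h : ∀ c, F.functor.obj c = F'.functor.obj c) : F = F' := by
  have hm : ∀ {c d : A} (g : c ⟶ d) (γ : F.functor.obj c) (δ : F'.functor.obj c), γ.1 = δ.1 →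
      (F.functor.map g γ).1 = (F'.functor.map g δ).1 := fun g γ δ hγδ =>
    K.mem_ext fun x => by rw [K.tup_map, K.tup_map, hγδ]
  apply Dual.ext
  obtain ⟨⟨o, m, _, _⟩, _⟩ := F
  obtain ⟨⟨o', m', _, _⟩, _⟩ := F'
  dsimp only at *
  obtain rfl : o = o' := funext h
  congr
  funext c d g x
  exact Subtype.ext (hm g x x rfl)

/-- A zero cone is fixed by the action of the endomorphism of `c` with label `0`, and by naturality
so is its image. -/
theorem tup_comp_eq_zero {F F' : Dual A} (η : F ⟶ F') (c : A) (γ : F.functor.obj c)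
    (h : ∀ x, K.tup γ.1 x = 0) (x : X) : K.tup (Dual.comp η c γ).1 x = 0 := by
  obtain ⟨f, hf⟩ := K.lab_surj (a := c) (b := c) 0 (fun _ => rfl)
  have : γ = F.functor.map f γ :=
    Subtype.ext (K.mem_ext fun x => by rw [K.tup_map, h, zero_mul])
  rw [this, Dual.naturality, K.tup_map, hf, mul_zero]

end Dual

/-! ### The functor of a sandwich matrix -/

section Sandwich

variable {X Y Z W A B : Type u} [GroupWithZero Z] [GroupWithZero W]
  [SmallCategory A] [HasInclusions A] [SmallCategory B] [HasInclusions B]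
  (K : Labelling X Z A) (J : Labelling Y W B) (φ : W ≃* Zᵐᵒᵖ) (P : X → Y → Z)

open Classical in
/-- The column of `P` at an object of `B`, which is the zero column at the zero object. -/
noncomputable def col (b : B) (x : X) : Z :=
  if h : ∃ y, b = J.p y then P x h.choose else 0

theorem col_z (x : X) : J.col P J.z x = 0 :=
  dif_neg fun ⟨y, hy⟩ => J.p_ne y hy.symm

theorem col_p (y : Y) (x : X) : J.col P (J.p y) x = P x y := by
  have h : ∃ y', J.p y = J.p y' := ⟨y, rfl⟩
  rw [col, dif_pos h, ← J.p_inj h.choose_spec]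

theorem eq_z_of_col {b : B} (hP : ∀ y, ∃ x, P x y ≠ 0) (h : ∀ x, J.col P b x = 0) : b = J.z := by
  rcases J.exhaust b with rfl | ⟨y, rfl⟩
  · rfl
  · obtain ⟨x, hx⟩ := hP y
    exact absurd ((J.col_p P y x).symm.trans (h x)) hx

/-- This makes the action of `g` on cones well defined: `δ` is found before the scalar `a`, which
`γ` need not determine. Either `g` has label `0` and every `a` gives the zero tuple, or column `b`
is nonzero and `a` is unique. -/
theorem exists_column_image {P : X → Y → Z} (hP : ∀ y, ∃ x, P x y ≠ 0)
    {b b' : B} (g : b ⟶ b') {c : A} {γ : NormalCone A}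
    (hc : SubObj γ.apex c) (hγ : ∃ a : Z, ∀ x, K.tup γ x = J.col P b x * a) :
    ∃ δ : NormalCone A, SubObj δ.apex c ∧ ∀ a : Z, (∀ x, K.tup γ x = J.col P b x * a) →
      ∀ x, K.tup δ x = J.col P b' x * ((φ (J.lab g)).unop * a) := by
  obtain ⟨a, ha⟩ := hγ
  by_cases hg : J.lab g = 0
  · obtain ⟨δ, hδ, ht⟩ := K.exists_zero_cone
    exact ⟨δ, K.subObj_iff.2 (Or.inl hδ), fun a' _ x => by simp [ht, hg]⟩
  obtain ⟨hb, hb'⟩ := J.ne_of_lab hg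
  obtain ⟨x, hx⟩ := not_forall.1 (mt (J.eq_z_of_col P hP) hb)
  have huniq : ∀ a', (∀ x, K.tup γ x = J.col P b x * a') → a' = a := fun a' ha' =>
    mul_left_cancel₀ hx ((ha' x).symm.trans (ha x))
  by_cases h0 : a = 0
  · obtain ⟨δ, hδ, ht⟩ := K.exists_zero_cone
    exact ⟨δ, K.subObj_iff.2 (Or.inl hδ), fun a' ha' x => by simp [ht, huniq a' ha', h0]⟩
  have hz : γ.apex ≠ K.z := fun h => mul_ne_zero hx h0
    ((ha x).symm.trans ((K.apex_eq_iff γ).1 h x))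
  obtain rfl := (K.subObj_iff.1 hc).resolve_left hz
  obtain ⟨x', hx'⟩ := not_forall.1 (mt (J.eq_z_of_col P hP) hb')
  obtain ⟨δ, hδ, ht⟩ := K.exists_cone (fun x => J.col P b' x * ((φ (J.lab g)).unop * a)) γ.apex
    ⟨fun h => absurd h hz, fun h => absurd (h x') (mul_ne_zero hx' (mul_ne_zero (by simpa) h0))⟩
  exact ⟨δ, by rw [hδ]; exact hc, fun a' ha' x => by rw [ht, huniq a' ha']⟩

variable [IsUnambiguous A]

/-- `F` is described by the columns of `P`: the value of `F b` at `c` consists of the cones with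
labels `p_b a` and apex below `c`, and `F g` sends a cone with labels `p_b a` to one with labels
`p_{b'} φ(g) a`. -/
structure IsColumnFunctor (F : B ⥤ Dual A) : Prop where
  mem_iff : ∀ (b : B) (c : A) (γ : NormalCone A), γ ∈ (F.obj b).functor.obj c ↔
    SubObj γ.apex c ∧ ∃ a : Z, ∀ x, K.tup γ x = J.col P b x * a
  tup_map : ∀ {b b' : B} (g : b ⟶ b') (c : A) (γ : (F.obj b).functor.obj c) (a : Z),
    (∀ x, K.tup γ.1 x = J.col P b x * a) →
    ∀ x, K.tup (Dual.comp (F.map g) c γ).1 x = J.col P b' x * ((φ (J.lab g)).unop * a)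

/-! ### Existence and uniqueness of column functors. -/

variable {P}

/-- Dividing a column by one of its nonzero entries and placing the apex at that entry gives label
`1` at the apex, hence an idempotent. The zero column is represented by the zero cone, where the
scalar is arbitrary. -/
theorem exists_column_cone (hP : ∀ y, ∃ x, P x y ≠ 0)
    (b : B) : ∃ (μ : NormalCone A) (_ : IsIdempotentElem μ) (u : Z),
    u ≠ 0 ∧ ∀ x, K.tup μ x = J.col P b x * u := by
  rcases J.exhaust b with rfl | ⟨y, rfl⟩
  · obtain ⟨μ, h, ht⟩ := K.exists_zero_cone
    exact ⟨μ, K.isIdempotentElem_of_apex h, 1, one_ne_zero, fun x => by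
      rw [ht, col_z, zero_mul]⟩
  · obtain ⟨x, hx⟩ := hP y
    obtain ⟨μ, h, ht⟩ := K.exists_cone (fun x' => P x' y * (P x y)⁻¹) (K.p x)
      ⟨fun h => absurd h (K.p_ne x), fun h => absurd (h x) (by simp [hx])⟩
    exact ⟨μ, K.isIdempotentElem_of_tup h (by rw [ht, mul_inv_cancel₀ hx]), (P x y)⁻¹,
      inv_ne_zero hx, fun x' => by rw [ht, col_p]⟩

theorem exists_column_dual (hP : ∀ y, ∃ x, P x y ≠ 0)
    (b : B) : ∃ F : Dual A, ∀ (c : A) (γ : NormalCone A),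
    γ ∈ F.functor.obj c ↔ SubObj γ.apex c ∧ ∃ a : Z, ∀ x, K.tup γ x = J.col P b x * a := by
  obtain ⟨μ, hμ, u, hu, ht⟩ := K.exists_column_cone J hP b
  refine ⟨⟨hFunctor μ hμ, μ, hμ, rfl⟩, fun c γ => ?_⟩
  dsimp only
  rw [K.mem_hFunctor]
  refine and_congr_right fun _ => ⟨?_, ?_⟩
  · rintro ⟨g, hg⟩
    exact ⟨u * g, fun x => by rw [hg, ht, mul_assoc]⟩
  · rintro ⟨a, ha⟩
    exact ⟨u⁻¹ * a, fun x => by rw [ha, ht, mul_assoc, mul_inv_cancel_left₀ hu]⟩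

/-- The morphisms of `B` act on the scalar from the left and those of `A` from the right. Naturality
is associativity, and functoriality is multiplicativity of `φ`. -/
theorem exists_isColumnFunctor (hP : ∀ y, ∃ x, P x y ≠ 0)
    : ∃ F : B ⥤ Dual A, IsColumnFunctor K J φ P F := by
  choose F hF using K.exists_column_dual J hP
  have H : ∀ {b b' : B} (g : b ⟶ b') (c : A) (γ : (F b).functor.obj c),
      ∃ δ : (F b').functor.obj c, ∀ a : Z, (∀ x, K.tup γ.1 x = J.col P b x * a) →
        ∀ x, K.tup δ.1 x = J.col P b' x * ((φ (J.lab g)).unop * a) := by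
    intro b b' g c γ
    obtain ⟨hc, a, ha⟩ := (hF b c γ.1).1 γ.2
    obtain ⟨δ, hδ, ht⟩ := K.exists_column_image J φ hP g hc ⟨a, ha⟩
    exact ⟨⟨δ, (hF b' c δ).2 ⟨hδ, _, ht a ha⟩⟩, ht⟩
  choose m hm using @H
  have hmem : ∀ {b : B} {c : A} (γ : (F b).functor.obj c),
      ∃ a : Z, ∀ x, K.tup γ.1 x = J.col P b x * a := fun γ => ((hF _ _ _).1 γ.2).2
  refine ⟨{ obj := F
            map := fun {b b'} g => Dual.mkHom (F := F b) (F' := F b') (m g) fun {c d} f γ => ?_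
            map_id := fun b => Dual.hom_ext fun c γ => ?_
            map_comp := fun {b b' b''} g h => Dual.hom_ext fun c γ => ?_ },
    hF, fun g c γ a ha => ?_⟩
  · obtain ⟨a, ha⟩ := hmem γ
    refine Subtype.ext (K.mem_ext fun x => ?_)
    rw [K.tup_map, hm g c γ a ha, hm g d _ (a * K.lab f)]
    · simp only [mul_assoc]
    · intro x
      rw [K.tup_map, ha, mul_assoc]
  · obtain ⟨a, ha⟩ := hmem γ
    refine K.mem_ext fun x => ?_
    rw [Dual.comp_mkHom, Dual.comp_id, hm (𝟙 b) c γ a ha, ha]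
    -- The identity of the zero object has label `0`, not `1`, but there the column vanishes.
    by_cases hb : b = J.z
    · rw [hb, col_z, zero_mul, zero_mul]
    · simp [J.lab_id hb]
  · obtain ⟨a, ha⟩ := hmem γ
    refine K.mem_ext fun x => ?_
    rw [Dual.comp_mkHom, Dual.comp_comp, Dual.comp_mkHom, Dual.comp_mkHom,
      hm (g ≫ h) c γ a ha, hm h c _ _ (hm g c γ a ha), J.lab_comp, map_mul, unop_mul]
    simp only [mul_assoc]
  · exact hm g c γ a ha

variable {K J φ}

theorem IsColumnFunctor.ext {F F' : B ⥤ Dual A} (hF : IsColumnFunctor K J φ P F)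
    (hF' : IsColumnFunctor K J φ P F') : F = F' := by
  have hobj : ∀ b, F.obj b = F'.obj b := fun b => K.dual_ext fun c => by
    ext γ
    rw [hF.mem_iff, hF'.mem_iff]
  -- The two functors agree on objects only propositionally, so their morphisms are compared by
  -- heterogeneous equality.
  refine CategoryTheory.Functor.hext hobj fun b b' g => Dual.hom_heq (hobj b) (hobj b') ?_
  intro c x y hxy
  obtain ⟨-, a, ha⟩ := (hF.mem_iff _ _ _).1 x.2
  refine K.mem_ext fun t => ?_
  rw [hF.tup_map g c x a ha, hF'.tup_map g c y a fun t => by rw [← hxy, ha]]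

/-! ### Column functors are local isomorphisms. -/

/-- The cone of `F b` with a given nonzero apex and the labels `p_b a`. -/
theorem IsColumnFunctor.exists_mem {F : B ⥤ Dual A} (hF : IsColumnFunctor K J φ P F) {b : B}
    {x : X} (hx : J.col P b x ≠ 0) {a : Z} (ha : a ≠ 0) (c : A) (hc : c ≠ K.z) :
    ∃ γ : (F.obj b).functor.obj c, ∀ x, K.tup γ.1 x = J.col P b x * a := by
  obtain ⟨γ, h, ht⟩ := K.exists_cone (fun x => J.col P b x * a) c
    ⟨fun h => absurd h hc, fun h => absurd (h x) (mul_ne_zero hx ha)⟩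
  exact ⟨⟨γ, (hF.mem_iff _ _ _).2 ⟨K.subObj_iff.2 (Or.inr h), a, ht⟩⟩, ht⟩

/-- If `b` and `b'` are nonzero, let `μ` be a cone with tuple `p_b` itself. Its image has tuple
`p_{b'} t`, and `t` determines the label of the required morphism. At a nonzero object `c` every
cone of `F b` is the image of `μ` under some morphism of `A`, so naturality leaves no further
freedom. -/
theorem IsColumnFunctor.full (hP : ∀ y, ∃ x, P x y ≠ 0)
    {F : B ⥤ Dual A} (hF : IsColumnFunctor K J φ P F) : F.Full where
  map_surjective {b b'} η := by
    have hmem : ∀ {b : B} {c : A} (γ : (F.obj b).functor.obj c),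
      ∃ a : Z, ∀ x, K.tup γ.1 x = J.col P b x * a := fun γ => ((hF.mem_iff _ _ _).1 γ.2).2
    by_cases hz : b = J.z ∨ b' = J.z
    · obtain ⟨g, hg⟩ := J.lab_surj (a := b) (b := b') 0 (fun _ => rfl)
      refine ⟨g, Dual.hom_ext fun c γ => K.mem_ext fun x => ?_⟩
      obtain ⟨a, ha⟩ := hmem γ
      rw [hF.tup_map g c γ a ha, hg, map_zero, unop_zero, zero_mul, mul_zero]
      rcases hz with rfl | rfl
      · rw [K.tup_comp_eq_zero η c γ fun x => by rw [ha, col_z, zero_mul]]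
      · obtain ⟨a', ha'⟩ := hmem (Dual.comp η c γ)
        rw [ha', col_z, zero_mul]
    · push Not at hz
      obtain ⟨x, hx⟩ := not_forall.1 (mt (J.eq_z_of_col P hP) hz.1)
      obtain ⟨μ, hμ⟩ := hF.exists_mem hx one_ne_zero (K.p x) (K.p_ne x)
      obtain ⟨t, ht⟩ := hmem (Dual.comp η _ μ)
      obtain ⟨g, hg⟩ := J.lab_surj (a := b) (b := b') (φ.symm (op t))
        (fun h => absurd h (by tauto))
      refine ⟨g, Dual.hom_ext fun c γ => K.mem_ext fun y => ?_⟩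
      obtain ⟨a, ha⟩ := hmem γ
      rw [hF.tup_map g c γ a ha, hg, MulEquiv.apply_symm_apply, unop_op]
      -- At the zero object only zero cones occur, and a nonzero label `a` would not be available
      -- there.
      by_cases hc : c = K.z
      · have h0 : ∀ y, K.tup γ.1 y = 0 := by
          rw [← K.apex_eq_iff]
          rcases K.subObj_iff.1 ((hF.mem_iff _ _ _).1 γ.2).1 with h | h
          · exact h
          · rw [h, hc]
        rw [K.tup_comp_eq_zero η c γ h0]
        rw [(mul_eq_zero.1 ((ha x).symm.trans (h0 x))).resolve_left hx, mul_zero, mul_zero]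
      · obtain ⟨f, hf⟩ := K.lab_surj (a := K.p x) (b := c) a
          (fun h => absurd h (by simp [K.p_ne, hc]))
        have : γ = (F.obj b).functor.map f μ := Subtype.ext (K.mem_ext fun y => by
          rw [K.tup_map, ha, hμ, mul_one, hf])
        rw [this, Dual.naturality, K.tup_map, ht, hf, mul_assoc]

/-- Evaluation at a cone with tuple `p_b` exhibits the label of the morphism as a left factor of the
scalar, which a nonzero entry of `p_{b'}` allows to be cancelled. -/
theorem IsColumnFunctor.faithful (hP : ∀ y, ∃ x, P x y ≠ 0)
    {F : B ⥤ Dual A} (hF : IsColumnFunctor K J φ P F) :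
    F.Faithful where
  map_injective {b b'} g h hgh := by
    by_cases hz : b = J.z ∨ b' = J.z
    · exact J.lab_inj (by rw [J.lab_zero g hz, J.lab_zero h hz])
    · push Not at hz
      obtain ⟨x, hx⟩ := not_forall.1 (mt (J.eq_z_of_col P hP) hz.1)
      obtain ⟨x', hx'⟩ := not_forall.1 (mt (J.eq_z_of_col P hP) hz.2)
      obtain ⟨μ, hμ⟩ := hF.exists_mem hx one_ne_zero (K.p x) (K.p_ne x)
      have h1 := hF.tup_map g _ μ 1 hμ x'
      rw [hgh, hF.tup_map h _ μ 1 hμ x', mul_one, mul_one] at h1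
      exact J.lab_inj (φ.injective (unop_injective (mul_left_cancel₀ hx' h1))).symm

theorem IsColumnFunctor.isIncl_map {F : B ⥤ Dual A} (hF : IsColumnFunctor K J φ P F) {b b' : B}
    (f : b ⟶ b') (hf : IsIncl f) : IsIncl (F.map f) := by
  intro c γ
  rcases (J.incl_iff f).1 hf with rfl | ⟨rfl, h⟩
  · obtain ⟨-, a, ha⟩ := (hF.mem_iff _ _ _).1 γ.2
    have h0 : ∀ x, K.tup γ.1 x = 0 := fun x => by rw [ha, col_z, zero_mul]
    exact K.mem_ext fun x => by rw [h0, K.tup_comp_eq_zero _ c γ h0]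
  · rw [J.eq_id_of_lab h, F.map_id]
    rfl

/-- The cone `μ` that represents the subobject lies in `F b`, so its tuple is `p_b a`. For `a = 0`
the subobject is the zero functor; otherwise `a` is invertible and every multiple of `p_b` is a
multiple of the tuple of `μ`. -/
theorem IsColumnFunctor.eq_or_eq {F : B ⥤ Dual A} (hF : IsColumnFunctor K J φ P F)
    {b : B} {e : Dual A} (h : SubObj e (F.obj b)) : e = F.obj J.z ∨ e = F.obj b := by
  obtain ⟨η, hη⟩ := h
  obtain ⟨_, μ, hμ, rfl⟩ := e
  have hsub : ∀ γ c, γ ∈ (hFunctor μ hμ).obj c → γ ∈ (F.obj b).functor.obj c := fun γ c hγ => by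
    have := (Dual.comp η c ⟨γ, hγ⟩).2
    rwa [hη c ⟨γ, hγ⟩] at this
  obtain ⟨-, a, ha⟩ := (hF.mem_iff _ _ _).1 (hsub μ _ (K.self_mem_hFunctor μ hμ))
  by_cases h0 : a = 0
  · left
    refine K.dual_ext fun c => ?_
    ext γ
    dsimp only
    rw [K.mem_hFunctor, hF.mem_iff]
    simp [ha, h0, col_z]
  · right
    refine K.dual_ext fun c => Set.Subset.antisymm (fun γ => hsub γ c) fun γ hγ => ?_
    obtain ⟨hc, t, ht⟩ := (hF.mem_iff _ _ _).1 hγ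
    exact (K.mem_hFunctor (hμ := hμ)).2 ⟨hc, a⁻¹ * t, fun x => by
      rw [ht, ha, mul_assoc, mul_inv_cancel_left₀ h0]⟩

theorem IsColumnFunctor.isLocalIso (hP : ∀ y, ∃ x, P x y ≠ 0)
    {F : B ⥤ Dual A} (hF : IsColumnFunctor K J φ P F) :
    IsLocalIso F where
  incl f hf := hF.isIncl_map f hf
  full := hF.full hP
  faithful := hF.faithful hP
  ideal b := by
    -- Injectivity on an ideal, which has at most two objects, only requires that a nonzero column
    -- and the zero column give different functors.
    have hne : ∀ b, b ≠ J.z → F.obj J.z ≠ F.obj b := by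
      intro b hb h
      obtain ⟨x, hx⟩ := not_forall.1 (mt (J.eq_z_of_col P hP) hb)
      obtain ⟨⟨μ, hm⟩, hμ⟩ := hF.exists_mem hx one_ne_zero (K.p x) (K.p_ne x)
      rw [← h, hF.mem_iff] at hm
      obtain ⟨-, a, ha⟩ := hm
      have := hμ x
      rw [ha, col_z, zero_mul, mul_one] at this
      exact hx this.symm
    refine ⟨fun d ⟨f, hf⟩ => ⟨F.map f, hF.isIncl_map f hf⟩, fun d hd d' hd' h => ?_,
      fun e he => ?_⟩
    · rcases J.subObj_iff.1 hd with rfl | rfl <;> rcases J.subObj_iff.1 hd' with rfl | rfl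
      · rfl
      · by_contra hb
        exact hne _ (Ne.symm hb) h
      · by_contra hb
        exact hne _ hb h.symm
      · rfl
    · rcases hF.eq_or_eq he with rfl | rfl
      · exact ⟨J.z, J.subObj_iff.2 (Or.inl rfl), rfl⟩
      · exact ⟨b, J.subObj_refl b, rfl⟩

/-! ### Representing cones and `M`-sets. -/

/-- An idempotent cone with labels `p_b u`, `u ≠ 0`, represents `F b`. -/
theorem IsColumnFunctor.eq_hFunctor {F : B ⥤ Dual A} (hF : IsColumnFunctor K J φ P F) {b : B}
    {μ : NormalCone A} (hμ : IsIdempotentElem μ) {u : Z} (hu : u ≠ 0)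
    (ht : ∀ x, K.tup μ x = J.col P b x * u) : hFunctor μ hμ = (F.obj b).functor := by
  refine congrArg Dual.functor
    (K.dual_ext (F := ⟨hFunctor μ hμ, μ, hμ, rfl⟩) (F' := F.obj b) fun c => ?_)
  ext γ
  dsimp only
  rw [K.mem_hFunctor, hF.mem_iff]
  refine and_congr_right fun _ => ⟨?_, ?_⟩
  · rintro ⟨g, hg⟩
    exact ⟨u * g, fun x => by rw [hg, ht, mul_assoc]⟩
  · rintro ⟨a, ha⟩
    exact ⟨u⁻¹ * a, fun x => by rw [ha, ht, mul_assoc, mul_inv_cancel_left₀ hu]⟩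

theorem IsColumnFunctor.tup_of_eq_hFunctor {F : B ⥤ Dual A} (hF : IsColumnFunctor K J φ P F)
    {b : B} {μ : NormalCone A} {hμ : IsIdempotentElem μ}
    (h : hFunctor μ hμ = (F.obj b).functor) : ∃ a : Z, ∀ x, K.tup μ x = J.col P b x * a := by
  have := K.self_mem_hFunctor μ hμ
  rw [h] at this
  exact ((hF.mem_iff _ _ _).1 this).2

/-- Every representing cone has a tuple `p_b a`, whose entry at `x` can be nonzero only if that of
`p_b` is; conversely `exists_column_cone` gives a representing cone with invertible scalar. -/
theorem IsColumnFunctor.p_mem_mSet (hP : ∀ y, ∃ x, P x y ≠ 0)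
    {F : B ⥤ Dual A} (hF : IsColumnFunctor K J φ P F) {b : B}
    {x : X} : K.p x ∈ (F.obj b).mSet ↔ J.col P b x ≠ 0 := by
  constructor
  · rintro ⟨μ, hμ, h, hi⟩
    obtain ⟨a, ha⟩ := hF.tup_of_eq_hFunctor h.symm
    rw [K.isIso_iff] at hi
    have := hi.resolve_right fun h => K.p_ne x h.1
    exact left_ne_zero_of_mul ((ha x).symm.trans_ne this)
  · intro hx
    obtain ⟨μ, hμ, u, hu, ht⟩ := K.exists_column_cone J hP b
    refine ⟨μ, hμ, (hF.eq_hFunctor hμ hu ht).symm, (K.isIso_iff _).2 (Or.inl ?_)⟩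
    exact (ht x).trans_ne (mul_ne_zero hx hu)

/-- The component at the zero object is an isomorphism only if the apex is zero, and then the
functor contains no nonzero cone. -/
theorem IsColumnFunctor.z_mem_mSet (hP : ∀ y, ∃ x, P x y ≠ 0)
    {F : B ⥤ Dual A} (hF : IsColumnFunctor K J φ P F) {b : B} :
    K.z ∈ (F.obj b).mSet ↔ b = J.z := by
  constructor
  · rintro ⟨μ, hμ, h, hi⟩
    rw [K.isIso_iff] at hi
    have h0 := (hi.resolve_left (not_not.2 (K.lab_zero _ (Or.inl rfl)))).2
    apply J.eq_z_of_col P hP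
    intro x
    by_contra hx
    obtain ⟨⟨γ, hm⟩, hγ⟩ := hF.exists_mem hx one_ne_zero (K.p x) (K.p_ne x)
    rw [h, K.mem_hFunctor] at hm
    obtain ⟨-, g, hg⟩ := hm
    have := hγ x
    rw [hg, (K.apex_eq_iff μ).1 h0, zero_mul, mul_one] at this
    exact hx this.symm
  · rintro rfl
    obtain ⟨μ, h, ht⟩ := K.exists_zero_cone
    exact ⟨μ, K.isIdempotentElem_of_apex h, (hF.eq_hFunctor _ one_ne_zero
      fun x => by rw [ht, col_z, zero_mul]).symm, (K.isIso_iff _).2 (Or.inr ⟨rfl, h⟩)⟩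

end Sandwich

end Labelling

/-! ## Labellings from inclusion preserving isomorphisms -/

namespace CUCat

variable {X Z : Type u} [GroupWithZero Z]

theorem label_ext {c d : CUCat X Z} {f g : c ⟶ d} (h : label f = label g) : f = g :=
  Subtype.ext h

theorem label_comp {c d e : CUCat X Z} (f : c ⟶ d) (g : d ⟶ e) :
    label (f ≫ g) = label f * label g := rfl

theorem label_id (x : X) : label (𝟙 (pt x : CUCat X Z)) = 1 := rfl

theorem label_eq_zero {c d : CUCat X Z} (f : c ⟶ d) (h : c = .zero ∨ d = .zero) : label f = 0 :=
  f.2 h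

theorem exists_hom {c d : CUCat X Z} (g : Z) (h : c = .zero ∨ d = .zero → g = 0) :
    ∃ f : c ⟶ d, label f = g := ⟨⟨g, h⟩, rfl⟩

theorem isIncl_iff {c d : CUCat X Z} (f : c ⟶ d) :
    IsIncl f ↔ c = .zero ∨ (c = d ∧ label f = 1) := by
  change (c = .zero ∨ ∃ h : c = d, f = eqToHom h) ↔ _
  cases c with
  | zero => simp
  | pt x =>
    refine or_congr_right ⟨?_, ?_⟩
    · rintro ⟨rfl, rfl⟩
      exact ⟨rfl, rfl⟩
    · rintro ⟨rfl, h⟩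
      exact ⟨rfl, label_ext h⟩

end CUCat

namespace IsInclusionIso

section

variable {X Z A : Type u} [GroupWithZero Z] [SmallCategory A] [HasInclusions A]
  {E : CUCat X Z ⥤ A} (hE : IsInclusionIso E)

theorem id_functor (C : Type u) [SmallCategory C] [HasInclusions C] : IsInclusionIso (𝟭 C) where
  bijective := Function.bijective_id
  full := inferInstance
  faithful := inferInstance
  incl_iff _ := Iff.rfl

/-- The object of `CUCat X Z` with a given image. -/
noncomputable def pre (a : A) : CUCat X Z := (hE.bijective.2 a).choose

theorem obj_pre (a : A) : E.obj (hE.pre a) = a := (hE.bijective.2 a).choose_spec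

theorem pre_obj (c : CUCat X Z) : hE.pre (E.obj c) = c := hE.bijective.1 (hE.obj_pre _)

/-- The label of the preimage of a morphism. -/
noncomputable def lab {a b : A} (f : a ⟶ b) : Z :=
  haveI := hE.full
  CUCat.label (E.preimage (eqToHom (hE.obj_pre a) ≫ f ≫ eqToHom (hE.obj_pre b).symm))

theorem lab_map {c d : CUCat X Z} (f : c ⟶ d) : hE.lab (E.map f) = CUCat.label f := by
  have := hE.full
  have := hE.faithful
  -- The preimage objects equal `c` and `d` only propositionally; generalising over them turns the
  -- `eqToHom` factors into identities.
  have key : ∀ (c' d' : CUCat X Z) (h : c' = c) (h' : d' = d) (h1 : E.obj c' = E.obj c)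
      (h2 : E.obj d = E.obj d'),
      CUCat.label (E.preimage (eqToHom h1 ≫ E.map f ≫ eqToHom h2)) = CUCat.label f := by
    rintro c' d' rfl rfl h1 h2
    simp
  exact key _ _ (hE.pre_obj c) (hE.pre_obj d) _ _

/-- The labelling of a category that is isomorphic to `CUCat X Z`. -/
noncomputable def labelling : Labelling X Z A :=
  haveI := hE.full
  haveI := hE.faithful
  { z := E.obj .zero
    p := fun x => E.obj (.pt x)
    p_inj := fun x y h => by simpa using hE.bijective.1 h
    p_ne := fun x h => by simpa using hE.bijective.1 h
    exhaust := fun a => by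
      obtain ⟨c, rfl⟩ := hE.bijective.2 a
      cases c with
      | zero => exact Or.inl rfl
      | pt x => exact Or.inr ⟨x, rfl⟩
    lab := hE.lab
    lab_inj := fun {a b f g} h => by
      obtain ⟨c, rfl⟩ := hE.bijective.2 a
      obtain ⟨d, rfl⟩ := hE.bijective.2 b
      obtain ⟨f, rfl⟩ := E.map_surjective f
      obtain ⟨g, rfl⟩ := E.map_surjective g
      rw [hE.lab_map, hE.lab_map] at h
      rw [CUCat.label_ext h]
    lab_surj := fun {a b} g h => by
      obtain ⟨c, rfl⟩ := hE.bijective.2 a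
      obtain ⟨d, rfl⟩ := hE.bijective.2 b
      obtain ⟨f, hf⟩ := CUCat.exists_hom (c := c) (d := d) g
        (fun h' => h (h'.imp (congrArg E.obj) (congrArg E.obj)))
      exact ⟨E.map f, (hE.lab_map f).trans hf⟩
    lab_zero := fun {a b} f h => by
      obtain ⟨c, rfl⟩ := hE.bijective.2 a
      obtain ⟨d, rfl⟩ := hE.bijective.2 b
      obtain ⟨f, rfl⟩ := E.map_surjective f
      rw [hE.lab_map]
      exact CUCat.label_eq_zero f (h.imp (fun h => hE.bijective.1 h) (fun h => hE.bijective.1 h))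
    lab_comp := fun {a b c} f g => by
      obtain ⟨a, rfl⟩ := hE.bijective.2 a
      obtain ⟨b, rfl⟩ := hE.bijective.2 b
      obtain ⟨c, rfl⟩ := hE.bijective.2 c
      obtain ⟨f, rfl⟩ := E.map_surjective f
      obtain ⟨g, rfl⟩ := E.map_surjective g
      rw [← E.map_comp, hE.lab_map, hE.lab_map, hE.lab_map, CUCat.label_comp]
    lab_id := fun {a} h => by
      obtain ⟨c, rfl⟩ := hE.bijective.2 a
      rw [← E.map_id, hE.lab_map]
      cases c with
      | zero => exact absurd rfl h
      | pt x => rfl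
    incl_iff := fun {a b} f => by
      obtain ⟨c, rfl⟩ := hE.bijective.2 a
      obtain ⟨d, rfl⟩ := hE.bijective.2 b
      obtain ⟨f, rfl⟩ := E.map_surjective f
      rw [hE.incl_iff, CUCat.isIncl_iff, hE.lab_map, hE.bijective.1.eq_iff,
        hE.bijective.1.eq_iff] }

theorem labelling_lab_map {c d : CUCat X Z} (f : c ⟶ d) :
    hE.labelling.lab (E.map f) = CUCat.label f := hE.lab_map f

theorem subObj_iff (hE : IsInclusionIso E) {c d : CUCat X Z} :
    SubObj (E.obj c) (E.obj d) ↔ SubObj c d := by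
  have := hE.full
  constructor
  · rintro ⟨f, hf⟩
    obtain ⟨f, rfl⟩ := E.map_surjective f
    exact ⟨f, (hE.incl_iff f).1 hf⟩
  · rintro ⟨f, hf⟩
    exact ⟨E.map f, (hE.incl_iff f).2 hf⟩

theorem isConeTuple_iff {γ : NormalCone A} {t : X → Z} {k : CUCat X Z} :
    IsConeTuple E γ t k ↔ γ.apex = E.obj k ∧ ∀ x, hE.labelling.tup γ x = t x := by
  have := hE.full
  constructor
  · rintro ⟨h, H⟩
    refine ⟨h, fun x => ?_⟩
    obtain ⟨f, hf, hf'⟩ := H x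
    rw [← hf, ← hE.labelling_lab_map, ← hf', Labelling.lab_comp_eqToHom]
    rfl
  · rintro ⟨h, H⟩
    refine ⟨h, fun x => ?_⟩
    obtain ⟨f, hf⟩ := E.map_surjective (γ.app (E.obj (.pt x)) ≫ eqToHom h)
    refine ⟨f, ?_, hf.symm⟩
    rw [← hE.labelling_lab_map, hf, Labelling.lab_comp_eqToHom]
    exact H x

end

/-- The description of column functors in terms of tuples. -/
theorem isColumnFunctor_iff {X Y Z W A B : Type u} [GroupWithZero Z] [GroupWithZero W]
    [SmallCategory A] [HasInclusions A] [IsUnambiguous A] [SmallCategory B] [HasInclusions B]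
    {E : CUCat X Z ⥤ A} (hE : IsInclusionIso E) {E' : CUCat Y W ⥤ B} (hE' : IsInclusionIso E')
    (φ : W ≃* Zᵐᵒᵖ) (P : X → Y → Z) (col : CUCat Y W → X → Z)
    (col_zero : ∀ x, col .zero x = 0) (col_pt : ∀ y x, col (.pt y) x = P x y)
    (F : B ⥤ Dual A) :
    Labelling.IsColumnFunctor hE.labelling hE'.labelling φ P F ↔
      (∀ (i : CUCat Y W) (c : CUCat X Z), (F.obj (E'.obj i)).functor.obj (E.obj c) =
        {γ | ∃ k, SubObj k c ∧ ∃ a : Z, IsConeTuple E γ (fun x => col i x * a) k}) ∧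
      ∀ (i j : CUCat Y W) (g : i ⟶ j) (c : CUCat X Z)
        (γ : (F.obj (E'.obj i)).functor.obj (E.obj c)) (a : Z) (k : CUCat X Z),
        IsConeTuple E γ.1 (fun x => col i x * a) k →
        ∃ k', IsConeTuple E (Dual.comp (F.map (E'.map g)) (E.obj c) γ).1
          (fun x => col j x * ((φ (CUCat.label g)).unop * a)) k' := by
  have := hE'.full
  have hcol : ∀ i x, hE'.labelling.col P (E'.obj i) x = col i x := by
    intro i x
    cases i with
    | zero => rw [col_zero]; exact hE'.labelling.col_z P x
    | pt y => rw [col_pt]; exact hE'.labelling.col_p P y x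
  have hobj : ∀ (i : CUCat Y W) (c : CUCat X Z) (γ : NormalCone A),
      (SubObj γ.apex (E.obj c) ∧ ∃ a : Z, ∀ x, hE.labelling.tup γ x = col i x * a) ↔
      ∃ k, SubObj k c ∧ ∃ a : Z, IsConeTuple E γ (fun x => col i x * a) k := by
    intro i c γ
    simp only [hE.isConeTuple_iff]
    constructor
    · rintro ⟨h, a, ha⟩
      obtain ⟨k, hk⟩ := hE.bijective.2 γ.apex
      rw [← hk, hE.subObj_iff] at h
      exact ⟨k, h, a, hk.symm, ha⟩
    · rintro ⟨k, h, a, hk, ha⟩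
      rw [hk, hE.subObj_iff]
      exact ⟨h, a, ha⟩
  constructor
  · intro hF
    refine ⟨fun i c => ?_, fun i j g c γ a k h => ?_⟩
    · ext γ
      rw [hF.mem_iff]
      simp only [hcol]
      exact hobj i c γ
    · obtain ⟨k', hk'⟩ := hE.bijective.2 (Dual.comp (F.map (E'.map g)) (E.obj c) γ).1.apex
      refine ⟨k', hE.isConeTuple_iff.2 ⟨hk'.symm, fun x => ?_⟩⟩
      rw [hF.tup_map (E'.map g) (E.obj c) γ a fun x => by
        rw [hcol, (hE.isConeTuple_iff.1 h).2 x], hcol, hE'.labelling_lab_map]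
  · rintro ⟨h1, h2⟩
    refine ⟨fun b c γ => ?_, fun {b b'} g c γ a h x => ?_⟩
    · obtain ⟨i, rfl⟩ := hE'.bijective.2 b
      obtain ⟨c, rfl⟩ := hE.bijective.2 c
      simp only [hcol]
      rw [hobj, h1]
      rfl
    · obtain ⟨i, rfl⟩ := hE'.bijective.2 b
      obtain ⟨j, rfl⟩ := hE'.bijective.2 b'
      obtain ⟨c, rfl⟩ := hE.bijective.2 c
      obtain ⟨g, rfl⟩ := E'.map_surjective g
      obtain ⟨k, hk⟩ := hE.bijective.2 γ.1.apex
      obtain ⟨k', hk'⟩ := h2 i j g c γ a k (hE.isConeTuple_iff.2 ⟨hk.symm, fun x => by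
        rw [h, hcol]⟩)
      rw [(hE.isConeTuple_iff.1 hk').2 x, hcol, hE'.labelling_lab_map]

end IsInclusionIso

/-! ## The cross-connection of a regular sandwich matrix -/

namespace CrossConnection

section

variable {G I L A B : Type u} [Group G] [SmallCategory A] [HasInclusions A] [IsUnambiguous A]
  [SmallCategory B] [HasInclusions B] [IsUnambiguous B] {P : L → I → WithZero G}

theorem ext_of_functors {Ω Ω' : CrossConnection A B} (h : Ω.Γ = Ω'.Γ) (h' : Ω.Δ = Ω'.Δ) :
    Ω = Ω' := by
  cases Ω
  cases Ω'
  congr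

variable (K : Labelling L (WithZero G) A) (J : Labelling I (WithZero G)ᵐᵒᵖ B)

/-- `Γ` and `Δ` are described by the columns and the rows of `P`. -/
structure IsOfMatrix (P : L → I → WithZero G) (Ω : CrossConnection A B) : Prop where
  Γ : Labelling.IsColumnFunctor K J (MulEquiv.refl _) P Ω.Γ
  Δ : Labelling.IsColumnFunctor J K (MulEquiv.opOp _) (fun i l => op (P l i)) Ω.Δ

/-- Regularity has two halves: nonzero columns make `Γ` a local isomorphism and nonzero rows do so
for `Δ`. For nonzero objects `l` and `i` both membership conditions say `P l i ≠ 0`, and a zero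
object is matched only with the other zero object. -/
theorem exists_isOfMatrix (hP : IsRegularSandwich P) :
    ∃ Ω : CrossConnection A B, Ω.IsOfMatrix K J P := by
  have hP' : ∀ l, ∃ i, op (P l i) ≠ 0 := fun l => by simpa using hP.1 l
  obtain ⟨Γ, hΓ⟩ := K.exists_isColumnFunctor J (MulEquiv.refl _) hP.2
  obtain ⟨Δ, hΔ⟩ := J.exists_isColumnFunctor K (MulEquiv.opOp _) hP'
  refine ⟨⟨Γ, Δ, hΓ.isLocalIso hP.2, hΔ.isLocalIso hP', fun c d => ?_⟩, hΓ, hΔ⟩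
  rcases K.exhaust c with rfl | ⟨l, rfl⟩ <;> rcases J.exhaust d with rfl | ⟨i, rfl⟩
  · rw [hΓ.z_mem_mSet hP.2, hΔ.z_mem_mSet hP']
    simp
  · rw [hΓ.z_mem_mSet hP.2, hΔ.p_mem_mSet hP', K.col_z]
    simp [J.p_ne]
  · rw [hΓ.p_mem_mSet hP.2, hΔ.z_mem_mSet hP', J.col_z]
    simp [K.p_ne]
  · rw [hΓ.p_mem_mSet hP.2, hΔ.p_mem_mSet hP', J.col_p, K.col_p]
    simp

variable {K J}

theorem IsOfMatrix.ext {Ω Ω' : CrossConnection A B} (h : Ω.IsOfMatrix K J P)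
    (h' : Ω'.IsOfMatrix K J P) : Ω = Ω' :=
  ext_of_functors (h.Γ.ext h'.Γ) (h.Δ.ext h'.Δ)

/-- For `Δ` the labels lie in the opposite of the group with zero, so the left multiples `a p_l`
become right multiples with scalar `op a`; translating the scalar is all that has to be done. -/
theorem isOfSandwich_iff {E : LeftCat G L ⥤ A} (hE : IsInclusionIso E) {E' : RightCat G I ⥤ B}
    (hE' : IsInclusionIso E') {Ω : CrossConnection A B} :
    Ω.IsOfSandwich P E E' ↔ Ω.IsOfMatrix hE.labelling hE'.labelling P := by
  have hΓ := hE.isColumnFunctor_iff hE' (MulEquiv.refl _) P (column P) (fun _ => rfl)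
    (fun _ _ => rfl) Ω.Γ
  have hΔ := hE'.isColumnFunctor_iff hE (MulEquiv.opOp _) (fun i l => op (P l i))
    (fun l i => op (row P l i)) (fun _ => rfl) (fun _ _ => rfl) Ω.Δ
  constructor
  · intro h
    refine ⟨hΓ.2 ⟨h.Γ_obj, fun i j => h.Γ_map⟩, hΔ.2 ⟨fun l d => ?_, fun l m g d δ a k hk => ?_⟩⟩
    · rw [h.Δ_obj]
      ext δ
      refine exists_congr fun k => and_congr_right fun _ => ?_
      exact ⟨fun ⟨a, ha⟩ => ⟨op a, ha⟩, fun ⟨a, ha⟩ => ⟨unop a, ha⟩⟩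
    · exact h.Δ_map g d δ (unop a) k hk
  · intro h
    refine ⟨(hΓ.1 h.Γ).1, (hΓ.1 h.Γ).2 _ _, fun l d => ?_, fun {l m} g d δ a k hk => ?_⟩
    · rw [(hΔ.1 h.Δ).1]
      ext δ
      refine exists_congr fun k => and_congr_right fun _ => ?_
      exact ⟨fun ⟨a, ha⟩ => ⟨unop a, ha⟩, fun ⟨a, ha⟩ => ⟨op a, ha⟩⟩
    · exact (hΔ.1 h.Δ).2 l m g d δ (op a) k hk

theorem existsUnique_isOfSandwich (hP : IsRegularSandwich P) {E : LeftCat G L ⥤ A}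
    (hE : IsInclusionIso E) {E' : RightCat G I ⥤ B} (hE' : IsInclusionIso E') :
    ∃! Ω : CrossConnection A B, Ω.IsOfSandwich P E E' := by
  obtain ⟨Ω, hΩ⟩ := exists_isOfMatrix hE.labelling hE'.labelling hP
  exact ⟨Ω, (isOfSandwich_iff hE hE').2 hΩ, fun Ω' h' =>
    ((isOfSandwich_iff hE hE').1 h').ext hΩ⟩

end

end CrossConnection

/-! ## The cross-connection semigroup -/

namespace Rees

variable {G I L : Type u} {P : L → I → WithZero G}

theorem mkZ_zero (i : I) (l : L) : mkZ P i 0 l = zero := rfl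

theorem mkZ_coe (i : I) (a : G) (l : L) : mkZ P i a l = mk i a l := rfl

theorem mkZ_injective {i : I} {l : L} {g h : WithZero G} (H : mkZ P i g l = mkZ P i h l) :
    g = h := by
  cases g with
  | zero =>
    cases h with
    | zero => rfl
    | coe b => exact absurd H (by rintro ⟨⟩)
  | coe a =>
    cases h with
    | zero => exact absurd H (by rintro ⟨⟩)
    | coe b => cases H; rfl

end Rees

namespace Labelling

variable {X Z A : Type u} [GroupWithZero Z] [SmallCategory A] [HasInclusions A]
  (K : Labelling X Z A) [IsUnambiguous A]

/-- The apex is `d` or zero. A zero apex would mean a zero tuple, and the nonzero label of `f` could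
be cancelled, making the apex of `γ` zero. -/
theorem apex_star {γ : NormalCone A} {d : A} {f : γ.apex ⟶ d} (hf : K.lab f ≠ 0) :
    (γ.star f).apex = d := by
  refine (K.subObj_iff.1 (subObj_star γ f)).resolve_left fun h => (K.ne_of_lab hf).1 ?_
  rw [apex_eq_iff] at h ⊢
  intro x
  have := h x
  rw [K.tup_star] at this
  exact (mul_eq_zero.1 this).resolve_right hf

theorem apex_star_eq_z {γ : NormalCone A} {d : A} {f : γ.apex ⟶ d} (hf : K.lab f = 0) :
    (γ.star f).apex = K.z :=
  (K.apex_eq_iff _).2 fun x => by rw [K.tup_star, hf, mul_zero]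

end Labelling

namespace CrossConnection

variable {G I L A B : Type u} [Group G] [SmallCategory A] [HasInclusions A]
  [SmallCategory B] [HasInclusions B] {P : L → I → WithZero G}
  (K : Labelling L (WithZero G) A) (J : Labelling I (WithZero G)ᵐᵒᵖ B)

/-- The element `(i,a,l)` is represented by the pair of cones with labels `p_i a`, `a p_l` and
apices `l`, `i`, and the zero element by the pair of zero cones. -/
def Represents : Rees P → NormalCone A × (NormalCone B)ᵐᵒᵖ → Prop
  | .zero, q => q.1.apex = K.z ∧ q.2.unop.apex = J.z
  | .mk i a l, q => (q.1.apex = K.p l ∧ ∀ l', K.tup q.1 l' = P l' i * a) ∧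
      q.2.unop.apex = J.p i ∧ ∀ i', J.tup q.2.unop i' = op (a * P l i')

/-- Regularity makes `p_i a` and `a p_l` nonzero tuples, as cones with nonzero apices require. -/
theorem exists_represents (hP : IsRegularSandwich P) (s : Rees P) :
    ∃ q, Represents K J s q := by
  cases s with
  | zero =>
    obtain ⟨γ, hγ, -⟩ := K.exists_zero_cone
    obtain ⟨δ, hδ, -⟩ := J.exists_zero_cone
    exact ⟨(γ, op δ), hγ, hδ⟩
  | mk i a l =>
    obtain ⟨l₀, h₁⟩ := hP.2 i
    obtain ⟨i₀, h₂⟩ := hP.1 l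
    obtain ⟨γ, hγ⟩ := K.exists_cone (fun l' => P l' i * a) (K.p l)
      ⟨fun h => absurd h (K.p_ne l), fun h => absurd (h l₀) (by simp [h₁])⟩
    obtain ⟨δ, hδ⟩ := J.exists_cone (fun i' => op (a * P l i')) (J.p i)
      ⟨fun h => absurd h (J.p_ne i), fun h => absurd (h i₀) (by simp [h₂])⟩
    exact ⟨(γ, op δ), hγ, hδ⟩

variable {K J}

theorem Represents.eq_right {s : Rees P} {q q' : NormalCone A × (NormalCone B)ᵐᵒᵖ}
    (h : Represents K J s q) (h' : Represents K J s q') : q = q' := by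
  cases s with
  | zero =>
    exact Prod.ext
      (K.cone_ext (h.1.trans h'.1.symm) fun x => by
        rw [(K.apex_eq_iff _).1 h.1, (K.apex_eq_iff _).1 h'.1])
      (unop_injective (J.cone_ext (h.2.trans h'.2.symm) fun x => by
        rw [(J.apex_eq_iff _).1 h.2, (J.apex_eq_iff _).1 h'.2]))
  | mk i a l =>
    exact Prod.ext
      (K.cone_ext (h.1.1.trans h'.1.1.symm) fun x => by rw [h.1.2, h'.1.2])
      (unop_injective (J.cone_ext (h.2.1.trans h'.2.1.symm) fun x => by rw [h.2.2, h'.2.2]))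

/-- The apices recover `l` and `i`, and a nonzero entry of column `i` recovers `a`. -/
theorem Represents.eq_left (hP : IsRegularSandwich P) {s s' : Rees P}
    {q : NormalCone A × (NormalCone B)ᵐᵒᵖ} (h : Represents K J s q)
    (h' : Represents K J s' q) : s = s' := by
  cases s with
  | zero =>
    cases s' with
    | zero => rfl
    | mk i a l => exact absurd (h'.1.1.symm.trans h.1) (K.p_ne l)
  | mk i a l =>
    cases s' with
    | zero => exact absurd (h.1.1.symm.trans h'.1) (K.p_ne l)
    | mk i' a' l' =>
      obtain rfl := K.p_inj (h.1.1.symm.trans h'.1.1)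
      obtain rfl := J.p_inj (h.2.1.symm.trans h'.2.1)
      obtain ⟨l₀, h₀⟩ := hP.2 i
      have := mul_left_cancel₀ h₀ ((h.1.2 l₀).symm.trans (h'.1.2 l₀))
      rw [WithZero.coe_inj.1 this]

/-! ### Products of representing pairs. -/

variable [IsUnambiguous A] [IsUnambiguous B]

/-- The cone of `p_j b` has label `p_{lj} b` at the apex `l` of the cone of `p_i a`, so the first
product has tuple `p_i (a p_{lj} b)`; dually the second has `(a p_{lj} b) p_k`. Both become zero
precisely when `p_{lj} = 0`. -/
theorem Represents.mul {s s' : Rees P} {q q' : NormalCone A × (NormalCone B)ᵐᵒᵖ}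
    (h : Represents K J s q) (h' : Represents K J s' q') :
    Represents K J (s * s') (q * q') := by
  have hfst : (q * q').1 = q.1 * q'.1 := rfl
  have hsnd : (q * q').2.unop = q'.2.unop * q.2.unop := rfl
  have hz : q.1.apex = K.z ∧ q.2.unop.apex = J.z ∨ q'.1.apex = K.z ∧ q'.2.unop.apex = J.z →
      Represents K J (.zero : Rees P) (q * q') := by
    intro hq
    refine ⟨?_, ?_⟩
    · rw [hfst]
      exact K.apex_star_eq_z (K.lab_zero _ (hq.imp And.left And.left))
    · rw [hsnd]
      exact J.apex_star_eq_z (J.lab_zero _ (hq.symm.imp And.right And.right))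
  cases s with
  | zero => exact hz (Or.inl h)
  | mk i a l =>
    cases s' with
    | zero => exact hz (Or.inr h')
    | mk j b k =>
      have h₁ : K.lab (q'.1.app q.1.apex) = P l j * b :=
        (K.lab_app_congr _ h.1.1).trans (h'.1.2 l)
      have h₂ : J.lab (q.2.unop.app q'.2.unop.apex) = op (a * P l j) :=
        (J.lab_app_congr _ h'.2.1).trans (h.2.2 j)
      rw [Rees.mk_mul_mk]
      by_cases hp : P l j = 0
      · rw [hp, mul_zero, zero_mul, Rees.mkZ_zero]
        refine ⟨?_, ?_⟩
        · rw [hfst]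
          exact K.apex_star_eq_z (by rw [h₁, hp, zero_mul])
        · rw [hsnd]
          exact J.apex_star_eq_z (by rw [h₂, hp, mul_zero, op_zero])
      · obtain ⟨p, hp'⟩ := WithZero.ne_zero_iff_exists.1 hp
        have hmk : Rees.mkZ P i (a * P l j * b) k = Rees.mk i (a * p * b) k := by
          rw [← hp', ← WithZero.coe_mul, ← WithZero.coe_mul, Rees.mkZ_coe]
        rw [hmk]
        refine ⟨⟨?_, fun l' => ?_⟩, ?_, fun i' => ?_⟩
        · rw [hfst, ← h'.1.1]
          exact K.apex_star (by rw [h₁]; exact mul_ne_zero hp WithZero.coe_ne_zero)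
        · rw [hfst, K.tup_mul, h₁, h.1.2, ← hp', WithZero.coe_mul, WithZero.coe_mul]
          simp only [mul_assoc]
        · rw [hsnd, ← h.2.1]
          exact J.apex_star (by simp [h₂, hp])
        · rw [hsnd, J.tup_mul, h₂, h'.2.2, ← hp', ← op_mul, WithZero.coe_mul, WithZero.coe_mul]
          simp only [mul_assoc]

/-! ### The linked pairs of the cross-connection of a matrix. -/

theorem IsOfMatrix.isGammaCone {Ω : CrossConnection A B} (hΩ : Ω.IsOfMatrix K J P) {l : L} {i : I}
    {μ : NormalCone A} (h : μ.apex = K.p l) (hp : P l i ≠ 0)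
    (ht : ∀ x, K.tup μ x = P x i * (P l i)⁻¹) : Ω.IsGammaCone (K.p l) (J.p i) μ := by
  have hμ := K.isIdempotentElem_of_tup h (by rw [ht, mul_inv_cancel₀ hp])
  exact ⟨h, hμ, hΩ.Γ.eq_hFunctor hμ (inv_ne_zero hp) fun x => by rw [ht, J.col_p]⟩

theorem IsOfMatrix.isDeltaCone {Ω : CrossConnection A B} (hΩ : Ω.IsOfMatrix K J P) {l : L} {i : I}
    {ν : NormalCone B} (h : ν.apex = J.p i) (hp : P l i ≠ 0)
    (ht : ∀ x, J.tup ν x = op (P l x) * (op (P l i))⁻¹) :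
    Ω.IsDeltaCone (K.p l) (J.p i) ν := by
  have hp' : op (P l i) ≠ 0 := by simpa
  have hν := J.isIdempotentElem_of_tup h (by rw [ht, mul_inv_cancel₀ hp'])
  exact ⟨h, hν, hΩ.Δ.eq_hFunctor hν (inv_ne_zero hp') fun x => by rw [ht, K.col_p]⟩

/-- The tuple is a multiple of column `i`, and an idempotent cone has label `1` at its apex `l`,
which fixes the scalar as the inverse of `P l i`. -/
theorem IsOfMatrix.tup_of_isGammaCone {Ω : CrossConnection A B} (hΩ : Ω.IsOfMatrix K J P) {l : L}
    {i : I} {c : A} {d : B} {μ : NormalCone A} (h : Ω.IsGammaCone c d μ) (hc : c = K.p l)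
    (hd : d = J.p i) (x : L) : K.tup μ x = P x i * (P l i)⁻¹ := by
  subst hc hd
  obtain ⟨h, hμ, hF⟩ := h
  obtain ⟨a, ha⟩ := hΩ.Γ.tup_of_eq_hFunctor hF
  simp only [J.col_p] at ha
  have h1 := (ha l).symm.trans (K.tup_apex h hμ)
  rw [ha, eq_inv_of_mul_eq_one_right h1]

theorem IsOfMatrix.tup_of_isDeltaCone {Ω : CrossConnection A B} (hΩ : Ω.IsOfMatrix K J P) {l : L}
    {i : I} {c : A} {d : B} {ν : NormalCone B} (h : Ω.IsDeltaCone c d ν) (hc : c = K.p l)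
    (hd : d = J.p i) (x : I) : J.tup ν x = op (P l x) * (op (P l i))⁻¹ := by
  subst hc hd
  obtain ⟨h, hν, hF⟩ := h
  obtain ⟨a, ha⟩ := hΩ.Δ.tup_of_eq_hFunctor hF
  simp only [K.col_p] at ha
  have h1 := (ha i).symm.trans (J.tup_apex h hν)
  rw [ha, eq_inv_of_mul_eq_one_right h1]

theorem IsOfMatrix.mem_mSet {Ω : CrossConnection A B} (hΩ : Ω.IsOfMatrix K J P)
    (hP : IsRegularSandwich P) {c : A} {d : B} : c ∈ (Ω.Γ.obj d).mSet ↔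
      (c = K.z ∧ d = J.z) ∨ ∃ l i, c = K.p l ∧ d = J.p i ∧ P l i ≠ 0 := by
  rcases K.exhaust c with rfl | ⟨l, rfl⟩
  · rw [hΩ.Γ.z_mem_mSet hP.2]
    simp [(K.p_ne _).symm]
  · rw [hΩ.Γ.p_mem_mSet hP.2]
    rcases J.exhaust d with rfl | ⟨i, rfl⟩
    · simp [J.col_z, K.p_ne, (J.p_ne _).symm]
    · simp [J.col_p, K.p_ne, K.p_inj.eq_iff, J.p_inj.eq_iff]

/-- The zero cones are themselves the cones `γ(0,0)` and `δ(0,0)`, linked by the identities of the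
zero objects. -/
theorem IsOfMatrix.linked_zero {Ω : CrossConnection A B} (hΩ : Ω.IsOfMatrix K J P)
    (hP : IsRegularSandwich P) {q : NormalCone A × (NormalCone B)ᵐᵒᵖ}
    (hq : Represents K J (.zero : Rees P) q) : Ω.Linked q.1 q.2.unop := by
  obtain ⟨γ, δ⟩ := q
  obtain ⟨δ⟩ := δ
  obtain ⟨hγ, hδ⟩ := hq
  change δ.apex = J.z at hδ
  change Ω.Linked γ δ
  dsimp only at hγ
  have h0 := (J.apex_eq_iff δ).1 hδ
  have hγ' : Ω.IsGammaCone γ.apex δ.apex γ := ⟨rfl, K.isIdempotentElem_of_apex hγ,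
    hΩ.Γ.eq_hFunctor _ one_ne_zero fun x => by
      rw [(K.apex_eq_iff γ).1 hγ, hδ, J.col_z, zero_mul]⟩
  have hδ' : Ω.IsDeltaCone γ.apex δ.apex δ := ⟨rfl, J.isIdempotentElem_of_apex hδ,
    hΩ.Δ.eq_hFunctor _ one_ne_zero fun x => by rw [h0, hγ, K.col_z, zero_mul]⟩
  have hm : γ.apex ∈ (Ω.Γ.obj δ.apex).mSet := (hΩ.mem_mSet hP).2 (Or.inl ⟨hγ, hδ⟩)
  refine ⟨γ.apex, γ, δ, δ, 𝟙 _, 𝟙 _, hm, (Ω.mem_mSet _ _).1 hm, hγ', hδ', hδ', ?_, ?_, ?_⟩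
  · intro x h m
    rw [Ω.Δ.map_id, Dual.comp_id, Category.id_comp]
  · exact K.cone_ext_of_subObj (K.subObj_refl _) (Labelling.subObj_star _ _) fun x => by
      rw [K.tup_star, (K.apex_eq_iff γ).1 hγ, zero_mul]
  · exact J.cone_ext_of_subObj (J.subObj_refl _) (Labelling.subObj_star _ _) fun x => by
      rw [J.tup_star, h0, zero_mul]

/-- With `l'` and `i'` such that `p_{l'i}` and `p_{li'}` are nonzero, take `f` with label `p_{l'i}
a` and `g` with label `a p_{li'}`. These factors cancel the normalisations of `γ(l',i)` and
`δ(l,i')`, leaving `p_i a` and `a p_l`; the same cancellations show that `g` is the transpose of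
`f`. -/
theorem IsOfMatrix.linked_mk {Ω : CrossConnection A B} (hΩ : Ω.IsOfMatrix K J P)
    (hP : IsRegularSandwich P) {i : I} {a : G} {l : L} {q : NormalCone A × (NormalCone B)ᵐᵒᵖ}
    (hq : Represents K J (.mk i a l : Rees P) q) : Ω.Linked q.1 q.2.unop := by
  obtain ⟨γ, δ⟩ := q
  obtain ⟨δ⟩ := δ
  obtain ⟨⟨hγ, hγt⟩, hδ, hδt⟩ := hq
  change δ.apex = J.p i at hδ
  change ∀ i', J.tup δ i' = _ at hδt
  change Ω.Linked γ δ
  dsimp only at hγ hγt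
  obtain ⟨l', hl'⟩ := hP.2 i
  obtain ⟨i', hi'⟩ := hP.1 l
  have hopi : op (P l i') ≠ 0 := by simpa
  have hopl : op (P l' i) ≠ 0 := by simpa
  obtain ⟨μ, hμ, hμt⟩ := K.exists_cone (fun x => P x i * (P l' i)⁻¹) (K.p l')
    ⟨fun h => absurd h (K.p_ne l'), fun h => absurd (h l') (by simp [hl'])⟩
  obtain ⟨κ, hκ, hκt⟩ := J.exists_cone (fun x => op (P l' x) * (op (P l' i))⁻¹) (J.p i)
    ⟨fun h => absurd h (J.p_ne i), fun h => absurd (h i) (mul_ne_zero hopl (inv_ne_zero hopl))⟩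
  obtain ⟨ν, hν, hνt⟩ := J.exists_cone (fun x => op (P l x) * (op (P l i'))⁻¹) (J.p i')
    ⟨fun h => absurd h (J.p_ne i'), fun h => absurd (h i') (mul_ne_zero hopi (inv_ne_zero hopi))⟩
  obtain ⟨f, hf⟩ := K.lab_surj (a := μ.apex) (b := K.p l) (P l' i * a)
    (fun h => absurd h (by simp [hμ, K.p_ne]))
  obtain ⟨g, hg⟩ := J.lab_surj (a := ν.apex) (b := κ.apex) (op (a * P l i'))
    (fun h => absurd h (by simp [hν, hκ, J.p_ne]))
  have hm : ∀ {l i c d}, c = K.p l → d = J.p i → P l i ≠ 0 → c ∈ (Ω.Γ.obj d).mSet :=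
    fun hc hd hp => (hΩ.mem_mSet hP).2 (Or.inr ⟨_, _, hc, hd, hp⟩)
  refine ⟨K.p l, μ, κ, ν, f, g, hm hμ hκ hl', (Ω.mem_mSet _ _).1 (hm rfl hν hi'), ?_, ?_, ?_, ?_,
    ?_, ?_⟩
  · rw [hμ, hκ]
    exact hΩ.isGammaCone hμ hl' hμt
  · rw [hμ, hκ]
    exact hΩ.isDeltaCone hκ hl' hκt
  · rw [hν]
    exact hΩ.isDeltaCone hν hi' hνt
  · intro x h m
    refine J.cone_ext_of_subObj (Labelling.subObj_of_mem (Dual.comp _ _ _).2)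
      (Labelling.subObj_star _ _) fun y => ?_
    have hcol : ∀ y, K.col (fun i l => op (P l i)) μ.apex y = op (P l' y) := fun y => by
      rw [hμ, K.col_p]
    -- The scalar of `κ ∗ h°` relative to row `l'` consists of the normalising factor of `κ` and the
    -- label of `h`.
    rw [hΩ.Δ.tup_map f x ⟨κ.star h, m⟩ ((op (P l' i))⁻¹ * J.lab h) fun y => by
      rw [J.tup_star, hκt, hcol, mul_assoc]]
    rw [K.col_p, J.tup_star, J.lab_comp, hνt, hf, hg]
    change op (P l y) * (op (P l' i * a) * _) = _
    rw [op_mul, op_mul, mul_assoc, mul_assoc, mul_inv_cancel_left₀ hopl, mul_assoc,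
      inv_mul_cancel_left₀ hopi]
  · refine K.cone_ext_of_subObj (K.subObj_iff.2 (Or.inr hγ)) (Labelling.subObj_star _ _)
      fun x => ?_
    rw [K.tup_star, hμt, hf, hγt, mul_assoc, inv_mul_cancel_left₀ hl']
  · refine J.cone_ext_of_subObj (J.subObj_iff.2 (Or.inr (hδ.trans hκ.symm)))
      (Labelling.subObj_star _ _) fun x => ?_
    rw [J.tup_star, hνt, hg, hδt, op_mul, op_mul, mul_assoc, inv_mul_cancel_left₀ hopi]

/-- The transpose equation says that `p_{l'i}⁻¹` times the label of `f` equals the label of `g`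
times `p_{li'}⁻¹`, the products being taken in the group with zero. This common value is the middle
coordinate `a`; in particular the two labels vanish together. -/
theorem IsOfMatrix.exists_represents_of_linked {Ω : CrossConnection A B}
    (hΩ : Ω.IsOfMatrix K J P) (hP : IsRegularSandwich P) {γ : NormalCone A} {δ : NormalCone B}
    (h : Ω.Linked γ δ) : ∃ s : Rees P, Represents K J s (γ, op δ) := by
  obtain ⟨c, μ, κ, ν, f, g, hm, hm', hμ, hκ, hν, ht, rfl, rfl⟩ := h
  by_cases h0 : K.lab f = 0 ∧ J.lab g = 0
  · exact ⟨.zero, K.apex_star_eq_z h0.1, J.apex_star_eq_z h0.2⟩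
  rw [hΩ.mem_mSet hP] at hm
  rw [← Ω.mem_mSet, hΩ.mem_mSet hP] at hm'
  rcases hm with ⟨h1, h2⟩ | ⟨l', i, h1, h2, hp⟩
  · exact absurd ⟨K.lab_zero f (Or.inl h1), J.lab_zero g (Or.inr h2)⟩ h0
  rcases hm' with ⟨h3, h4⟩ | ⟨l, i', rfl, h4, hp'⟩
  · exact absurd ⟨K.lab_zero f (Or.inr h3), J.lab_zero g (Or.inl h4)⟩ h0
  have hμt := hΩ.tup_of_isGammaCone hμ h1 h2
  have hκt := hΩ.tup_of_isDeltaCone hκ h1 h2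
  have hνt := hΩ.tup_of_isDeltaCone hν rfl h4
  have hopi : op (P l i') ≠ 0 := by simpa
  have hopl : op (P l' i) ≠ 0 := by simpa
  obtain ⟨_, hκi, hF⟩ := hκ
  -- Evaluating the transpose condition at the identity of the apex of `κ` and comparing labels at
  -- `i'` suffices, since `P l i'` can be cancelled.
  have key : op (K.lab f) * (op (P l' i))⁻¹ = (op (P l i'))⁻¹ * J.lab g := by
    have hmem : κ.star (𝟙 κ.apex) ∈ (Ω.Δ.obj μ.apex).functor.obj κ.apex := by
      rw [← hF]
      exact ⟨𝟙 _, rfl⟩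
    have h5 := congrArg (fun ε => J.tup ε i') (ht κ.apex (𝟙 _) hmem)
    have hcol : ∀ y, K.col (fun i l => op (P l i)) μ.apex y = op (P l' y) := fun y => by
      rw [h1, K.col_p]
    have hlab : J.lab (𝟙 κ.apex) = 1 := J.lab_id (by rw [h2]; exact J.p_ne i)
    rw [hΩ.Δ.tup_map f κ.apex ⟨_, hmem⟩ (op (P l' i))⁻¹ fun y => by
      rw [J.tup_star, hκt, hcol, hlab, mul_one]] at h5
    rw [K.col_p, J.tup_star, Category.comp_id, hνt, mul_assoc] at h5
    exact mul_left_cancel₀ hopi h5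
  have hf : K.lab f ≠ 0 := by
    intro hf
    rw [hf, op_zero, zero_mul] at key
    exact h0 ⟨hf, (mul_eq_zero.1 key.symm).resolve_left (inv_ne_zero hopi)⟩
  have hg : J.lab g ≠ 0 := by
    intro hg
    rw [hg, mul_zero] at key
    exact hf (by simpa [hp] using key)
  obtain ⟨a, ha⟩ := WithZero.ne_zero_iff_exists.1 (mul_ne_zero (inv_ne_zero hp) hf)
  refine ⟨.mk i a l, ⟨K.apex_star hf, fun x => ?_⟩, (J.apex_star hg).trans h2, fun x => ?_⟩
  · rw [K.tup_star, hμt, ha, mul_assoc]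
  · change J.tup (ν.star g) x = _
    rw [J.tup_star, hνt, ha, op_mul, op_mul, mul_assoc, ← key, MulOpposite.op_inv]

theorem IsOfMatrix.mem_linkedPairs {Ω : CrossConnection A B} (hΩ : Ω.IsOfMatrix K J P)
    (hP : IsRegularSandwich P) {q : NormalCone A × (NormalCone B)ᵐᵒᵖ} :
    q ∈ Ω.linkedPairs ↔ ∃ s : Rees P, Represents K J s q := by
  refine ⟨fun h => hΩ.exists_represents_of_linked hP h, ?_⟩
  rintro ⟨s, hs⟩
  cases s with
  | zero => exact hΩ.linked_zero hP hs
  | mk i a l => exact hΩ.linked_mk hP hs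

/-- The choice of the unique representing pair is an injective homomorphism whose range is the set
of linked pairs; closure under the product is then closure of a range. -/
theorem IsOfMatrix.exists_linkedPairs_equiv {Ω : CrossConnection A B} (hΩ : Ω.IsOfMatrix K J P)
    (hP : IsRegularSandwich P) : ∃ T : Subsemigroup (NormalCone A × (NormalCone B)ᵐᵒᵖ),
      (T : Set _) = Ω.linkedPairs ∧ Nonempty (T ≃* Rees P) := by
  choose ψ hψ using exists_represents K J hP
  let Ψ : Rees P →ₙ* NormalCone A × (NormalCone B)ᵐᵒᵖ :=
    { toFun := ψ
      map_mul' := fun s t => (hψ _).eq_right ((hψ s).mul (hψ t)) }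
  refine ⟨Ψ.srange, ?_, ⟨(MulEquiv.ofBijective Ψ.srangeRestrict
    ⟨fun s t h => ?_, Ψ.srangeRestrict_surjective⟩).symm⟩⟩
  · ext q
    rw [hΩ.mem_linkedPairs hP]
    exact ⟨fun ⟨s, hs⟩ => ⟨s, hs ▸ hψ s⟩, fun ⟨s, hs⟩ => ⟨s, (hψ s).eq_right hs⟩⟩
  · have h' : ψ s = ψ t := congrArg Subtype.val h
    have hs := hψ s
    rw [h'] at hs
    exact hs.eq_left hP (hψ t)

end CrossConnection

/-! ## The ideal categories of a Rees matrix semigroup -/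

section Coordinates

variable {G I L : Type u} [Group G] {P : L → I → WithZero G}

namespace Rees

theorem isIdempotentElem_mk {i : I} {l : L} {p : G} (hp : P l i = p) :
    IsIdempotentElem (mk i p⁻¹ l : Rees P) := by
  change mk i p⁻¹ l * mk i p⁻¹ l = (mk i p⁻¹ l : Rees P)
  rw [mk_mul_mk, hp, ← WithZero.coe_mul, ← WithZero.coe_mul, inv_mul_cancel, one_mul, mkZ_coe]

theorem isIdempotentElem_zero : IsIdempotentElem (zero : Rees P) := rfl

theorem mkZ_mem_leftIdeal (i : I) (g : WithZero G) (l : L) :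
    mkZ P i g l ∈ leftIdeal P (.pt l) := by
  cases g with
  | zero => exact Or.inl rfl
  | coe a => exact Or.inr ⟨i, a, rfl⟩

theorem mkZ_mem_rightIdeal (i : I) (g : WithZero G) (l : L) :
    mkZ P i g l ∈ rightIdeal P (.pt i) := by
  cases g with
  | zero => exact Or.inl rfl
  | coe a => exact Or.inr ⟨a, l, rfl⟩

theorem leftIdeal_zero : leftIdeal P (.zero : LeftCat G L) = {x | ∃ s, x = s * zero} := by
  ext x
  exact ⟨fun h => ⟨zero, h⟩, fun ⟨s, hs⟩ => hs.trans (mul_zero' s)⟩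

theorem rightIdeal_zero : rightIdeal P (.zero : RightCat G I) = {x | ∃ s, x = zero * s} := by
  ext x
  exact ⟨fun h => ⟨zero, h⟩, fun ⟨_, hs⟩ => hs⟩

/-- Right multiplication by this idempotent fixes every element with last coordinate `l`, so the
ideal is independent of the choice of `i`. -/
theorem leftIdeal_pt {i : I} {l : L} {p : G} (hp : P l i = p) :
    leftIdeal P (.pt l : LeftCat G L) = {x | ∃ s, x = s * mk i p⁻¹ l} := by
  ext x
  constructor
  · rintro (rfl | ⟨j, a, rfl⟩)
    · exact ⟨zero, rfl⟩
    · refine ⟨mk j a l, ?_⟩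
      rw [mk_mul_mk, hp, ← WithZero.coe_mul, ← WithZero.coe_mul, mul_inv_cancel_right, mkZ_coe]
  · rintro ⟨s, rfl⟩
    cases s with
    | zero => exact Or.inl rfl
    | mk j a k => exact mkZ_mem_leftIdeal _ _ _

theorem rightIdeal_pt {i : I} {l : L} {p : G} (hp : P l i = p) :
    rightIdeal P (.pt i : RightCat G I) = {x | ∃ s, x = mk i p⁻¹ l * s} := by
  ext x
  constructor
  · rintro (rfl | ⟨a, k, rfl⟩)
    · exact ⟨zero, rfl⟩
    · refine ⟨mk i a k, ?_⟩
      rw [mk_mul_mk, hp, ← WithZero.coe_mul, ← WithZero.coe_mul, inv_mul_cancel, one_mul, mkZ_coe]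
  · rintro ⟨s, rfl⟩
    cases s with
    | zero => exact Or.inl rfl
    | mk j a k => exact mkZ_mem_rightIdeal _ _ _

/-- The idempotents are `0` and the elements `(i,p_{li}⁻¹,l)`. -/
theorem idempotent_cases {e : Rees P} (he : IsIdempotentElem e) :
    e = zero ∨ ∃ i l p, P l i = ((p : G) : WithZero G) ∧ e = mk i p⁻¹ l := by
  cases e with
  | zero => exact Or.inl rfl
  | mk i a l =>
    right
    have h : mkZ P i (a * P l i * a) l = mkZ P i a l := he
    have h1 := mkZ_injective h
    have h2 : (a : WithZero G) * P l i = 1 := by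
      refine mul_right_cancel₀ (b := (a : WithZero G)) WithZero.coe_ne_zero ?_
      rw [h1, one_mul]
    exact ⟨i, l, a⁻¹, by rw [WithZero.coe_inv]; exact eq_inv_of_mul_eq_one_right h2, by simp⟩

/-! ### Labelled morphisms as translations of ideals. -/

/-- `(i,a,l) ↦ (i,ag,k)` for the object `k`, and the zero map for the object `0`. -/
def rightMul (d : LeftCat G L) (g : WithZero G) : Rees P → Rees P
  | .zero => .zero
  | .mk i a _ => match d with
    | .zero => .zero
    | .pt k => mkZ P i (a * g) k

/-- `(i,a,l) ↦ (j,ga,l)` for the object `j`, and the zero map for the object `0`. -/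
def leftMul (d : RightCat G I) (g : WithZero G) : Rees P → Rees P
  | .zero => .zero
  | .mk _ a l => match d with
    | .zero => .zero
    | .pt j => mkZ P j (g * a) l

theorem rightMul_zero_left (g : WithZero G) (x : Rees P) : rightMul .zero g x = zero := by
  cases x <;> rfl

theorem rightMul_mkZ (k : L) (i : I) (a g : WithZero G) (l : L) :
    rightMul (.pt k) g (mkZ P i a l) = mkZ P i (a * g) k := by
  cases a with
  | zero => exact (congrArg (fun t => mkZ P i t k) (zero_mul g)).symm
  | coe a => rfl

theorem leftMul_zero_left (g : WithZero G) (x : Rees P) : leftMul .zero g x = zero := by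
  cases x <;> rfl

theorem leftMul_mkZ (j i : I) (a g : WithZero G) (l : L) :
    leftMul (.pt j) g (mkZ P i a l) = mkZ P j (g * a) l := by
  cases a with
  | zero => exact (congrArg (fun t => mkZ P j t l) (mul_zero g)).symm
  | coe a => rfl

theorem rightMul_mem (d : LeftCat G L) (g : WithZero G) (x : Rees P) :
    rightMul d g x ∈ leftIdeal P d := by
  cases d with
  | zero => exact rightMul_zero_left g x
  | pt k =>
    cases x with
    | zero => exact Or.inl rfl
    | mk i a l => exact mkZ_mem_leftIdeal _ _ _

theorem leftMul_mem (d : RightCat G I) (g : WithZero G) (x : Rees P) :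
    leftMul d g x ∈ rightIdeal P d := by
  cases d with
  | zero => exact leftMul_zero_left g x
  | pt k =>
    cases x with
    | zero => exact Or.inl rfl
    | mk i a l => exact mkZ_mem_rightIdeal _ _ _

theorem zero_mem_leftIdeal (c : LeftCat G L) : zero ∈ leftIdeal P c := by
  cases c with
  | zero => rfl
  | pt l => exact Or.inl rfl

theorem zero_mem_rightIdeal (c : RightCat G I) : zero ∈ rightIdeal P c := by
  cases c with
  | zero => rfl
  | pt l => exact Or.inl rfl

theorem exists_leftIdeal_eq (hP : IsRegularSandwich P) (c : LeftCat G L) :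
    ∃ e : Rees P, IsIdempotentElem e ∧ leftIdeal P c = {x | ∃ s, x = s * e} := by
  cases c with
  | zero => exact ⟨zero, isIdempotentElem_zero, leftIdeal_zero⟩
  | pt l =>
    obtain ⟨i, hi⟩ := hP.1 l
    obtain ⟨p, hp⟩ := WithZero.ne_zero_iff_exists.1 hi
    exact ⟨mk i p⁻¹ l, isIdempotentElem_mk hp.symm, leftIdeal_pt hp.symm⟩

theorem exists_rightIdeal_eq (hP : IsRegularSandwich P) (c : RightCat G I) :
    ∃ e : Rees P, IsIdempotentElem e ∧ rightIdeal P c = {x | ∃ s, x = e * s} := by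
  cases c with
  | zero => exact ⟨zero, isIdempotentElem_zero, rightIdeal_zero⟩
  | pt i =>
    obtain ⟨l, hl⟩ := hP.2 i
    obtain ⟨p, hp⟩ := WithZero.ne_zero_iff_exists.1 hl
    exact ⟨mk i p⁻¹ l, isIdempotentElem_mk hp.symm, rightIdeal_pt hp.symm⟩

theorem rightMul_translation (hP : IsRegularSandwich P) {c d : LeftCat G L} (φ : c ⟶ d) :
    ∃ e u f : Rees P, IsIdempotentElem e ∧ IsIdempotentElem f ∧
      leftIdeal P c = {x | ∃ s, x = s * e} ∧ leftIdeal P d = {x | ∃ s, x = s * f} ∧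
      (∃ s, u = e * s * f) ∧
      ∀ x : leftIdeal P c, rightMul d (CUCat.label φ) (x : Rees P) = x * u := by
  obtain ⟨e, he, hc⟩ := exists_leftIdeal_eq hP c
  obtain ⟨f, hf, hd⟩ := exists_leftIdeal_eq hP d
  cases c with
  | zero =>
    refine ⟨e, zero, f, he, hf, hc, hd, ⟨zero, ?_⟩, ?_⟩
    · rw [mul_zero', zero_mul']
    · rintro ⟨_, rfl⟩
      rfl
  | pt l =>
    cases d with
    | zero =>
      refine ⟨e, zero, f, he, hf, hc, hd, ⟨zero, ?_⟩, fun x => ?_⟩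
      · rw [mul_zero', zero_mul']
      · rw [mul_zero', rightMul_zero_left]
    | pt k =>
      obtain ⟨i, hi⟩ := hP.1 l
      obtain ⟨p, hp⟩ := WithZero.ne_zero_iff_exists.1 hi
      obtain ⟨j, hj⟩ := hP.1 k
      obtain ⟨q, hq⟩ := WithZero.ne_zero_iff_exists.1 hj
      -- Multiplication by an element with first coordinate `i` inserts the sandwich entry `p`; the
      -- factor `p⁻¹` in the translating element cancels it and leaves the label.
      refine ⟨mk i p⁻¹ l, mkZ P i (p⁻¹ * CUCat.label φ) k, mk j q⁻¹ k,
        isIdempotentElem_mk hp.symm, isIdempotentElem_mk hq.symm, leftIdeal_pt hp.symm,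
        leftIdeal_pt hq.symm, ⟨mkZ P i (p⁻¹ * CUCat.label φ) k, ?_⟩, ?_⟩
      · rw [mk_mul_mkZ, mkZ_mul_mk, ← hp, ← hq]
        simp [mul_assoc]
      · rintro ⟨_, rfl | ⟨i', a, rfl⟩⟩
        · rfl
        · change mkZ P i' (a * CUCat.label φ) k = _
          rw [mk_mul_mkZ, ← hp]
          simp [mul_assoc]

theorem leftMul_translation (hP : IsRegularSandwich P) {c d : RightCat G I} (φ : c ⟶ d) :
    ∃ e u f : Rees P, IsIdempotentElem e ∧ IsIdempotentElem f ∧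
      rightIdeal P c = {x | ∃ s, x = e * s} ∧ rightIdeal P d = {x | ∃ s, x = f * s} ∧
      (∃ s, u = f * s * e) ∧
      ∀ x : rightIdeal P c, leftMul d (CUCat.label φ).unop (x : Rees P) = u * x := by
  obtain ⟨e, he, hc⟩ := exists_rightIdeal_eq hP c
  obtain ⟨f, hf, hd⟩ := exists_rightIdeal_eq hP d
  cases c with
  | zero =>
    refine ⟨e, zero, f, he, hf, hc, hd, ⟨zero, ?_⟩, ?_⟩
    · rw [mul_zero', zero_mul']
    · rintro ⟨_, rfl⟩
      rfl
  | pt i =>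
    cases d with
    | zero =>
      refine ⟨e, zero, f, he, hf, hc, hd, ⟨zero, ?_⟩, fun x => ?_⟩
      · rw [mul_zero', zero_mul']
      · rw [zero_mul', leftMul_zero_left]
    | pt j =>
      obtain ⟨l, hl⟩ := hP.2 i
      obtain ⟨p, hp⟩ := WithZero.ne_zero_iff_exists.1 hl
      obtain ⟨k, hk⟩ := hP.2 j
      obtain ⟨q, hq⟩ := WithZero.ne_zero_iff_exists.1 hk
      refine ⟨mk i p⁻¹ l, mkZ P j ((CUCat.label φ).unop * p⁻¹) l, mk j q⁻¹ k,
        isIdempotentElem_mk hp.symm, isIdempotentElem_mk hq.symm, rightIdeal_pt hp.symm,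
        rightIdeal_pt hq.symm, ⟨mkZ P j ((CUCat.label φ).unop * p⁻¹) l, ?_⟩, ?_⟩
      · rw [mk_mul_mkZ, mkZ_mul_mk, ← hp, ← hq]
        simp
      · rintro ⟨_, rfl | ⟨a, l', rfl⟩⟩
        · exact (mul_zero' _).symm
        · change mkZ P j ((CUCat.label φ).unop * a) l' = _
          rw [mkZ_mul_mk, ← hp]
          simp

end Rees

/-- The identification of `LeftCat G L` with `𝕃(M°(G;I,L;P))`. -/
def leftCoordinates (hP : IsRegularSandwich P) : LeftCat G L ⥤ LeftIdeals (Rees P) where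
  obj c := ⟨leftIdeal P c, Rees.exists_leftIdeal_eq hP c⟩
  map {c d} φ := (⟨fun x => ⟨Rees.rightMul d (CUCat.label φ) x.1, Rees.rightMul_mem _ _ _⟩,
    Rees.rightMul_translation hP φ⟩ : LeftIdeals.Hom _ _)
  map_id c := by
    refine LeftIdeals.Hom.ext (funext fun x => Subtype.ext ?_)
    obtain ⟨x, hx⟩ := x
    change Rees.rightMul c _ x = x
    cases c with
    | zero => exact (Rees.rightMul_zero_left _ _).trans hx.symm
    | pt l =>
      rcases hx with rfl | ⟨i, a, rfl⟩
      · rfl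
      · change Rees.mkZ P i (a * CUCat.label _) l = _
        rw [CUCat.label_id, mul_one, Rees.mkZ_coe]
  map_comp {c d e} φ ψ := by
    refine LeftIdeals.Hom.ext (funext fun x => Subtype.ext ?_)
    obtain ⟨x, hx⟩ := x
    change Rees.rightMul e (CUCat.label φ * CUCat.label ψ) x =
      Rees.rightMul e (CUCat.label ψ) (Rees.rightMul d (CUCat.label φ) x)
    cases e with
    | zero => rw [Rees.rightMul_zero_left, Rees.rightMul_zero_left]
    | pt m =>
      cases x with
      | zero => rfl
      | mk i a l =>
        cases d with
        | zero =>
          rw [CUCat.label_eq_zero φ (Or.inr rfl), zero_mul]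
          change Rees.mkZ P i (a * 0) m = .zero
          rw [mul_zero, Rees.mkZ_zero]
        | pt k =>
          change Rees.mkZ P i _ m = Rees.rightMul _ _ (Rees.mkZ P i _ k)
          rw [Rees.rightMul_mkZ, mul_assoc]

/-- The identification of `RightCat G I` with `ℝ(M°(G;I,L;P))`. -/
def rightCoordinates (hP : IsRegularSandwich P) : RightCat G I ⥤ RightIdeals (Rees P) where
  obj c := ⟨rightIdeal P c, Rees.exists_rightIdeal_eq hP c⟩
  map {c d} φ := (⟨fun x => ⟨Rees.leftMul d (CUCat.label φ).unop x.1, Rees.leftMul_mem _ _ _⟩,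
    Rees.leftMul_translation hP φ⟩ : RightIdeals.Hom _ _)
  map_id c := by
    refine RightIdeals.Hom.ext (funext fun x => Subtype.ext ?_)
    obtain ⟨x, hx⟩ := x
    change Rees.leftMul c _ x = x
    cases c with
    | zero => exact (Rees.leftMul_zero_left _ _).trans hx.symm
    | pt i =>
      rcases hx with rfl | ⟨a, l, rfl⟩
      · rfl
      · change Rees.mkZ P i ((CUCat.label (𝟙 (.pt i : RightCat G I))).unop * a) l = _
        rw [CUCat.label_id, unop_one, one_mul, Rees.mkZ_coe]
  map_comp {c d e} φ ψ := by
    refine RightIdeals.Hom.ext (funext fun x => Subtype.ext ?_)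
    obtain ⟨x, hx⟩ := x
    change Rees.leftMul e ((CUCat.label ψ).unop * (CUCat.label φ).unop) x =
      Rees.leftMul e (CUCat.label ψ).unop (Rees.leftMul d (CUCat.label φ).unop x)
    cases e with
    | zero => rw [Rees.leftMul_zero_left, Rees.leftMul_zero_left]
    | pt m =>
      cases x with
      | zero => rfl
      | mk i a l =>
        cases d with
        | zero =>
          rw [CUCat.label_eq_zero φ (Or.inr rfl), unop_zero, mul_zero]
          change Rees.mkZ P m (0 * a) l = .zero
          rw [zero_mul, Rees.mkZ_zero]
        | pt k =>
          change Rees.mkZ P m _ l = Rees.leftMul _ _ (Rees.mkZ P k _ l)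
          rw [Rees.leftMul_mkZ, mul_assoc]

theorem isLeftCoordinates (hP : IsRegularSandwich P) :
    IsLeftCoordinates P (leftCoordinates hP) :=
  ⟨fun _ => rfl, fun _ _ _ _ _ _ => rfl⟩

theorem isRightCoordinates (hP : IsRegularSandwich P) :
    IsRightCoordinates P (rightCoordinates hP) :=
  ⟨fun _ => rfl, fun _ _ _ _ _ _ => rfl⟩

theorem isInclusionIso_leftCoordinates (hP : IsRegularSandwich P) :
    IsInclusionIso (leftCoordinates hP) where
  bijective := by
    constructor
    · intro c d h
      have h : leftIdeal P c = leftIdeal P d := congrArg LeftIdeals.carrier h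
      have key : ∀ (l : L) (d : LeftCat G L), leftIdeal P (.pt l) = leftIdeal P d →
          (.pt l : LeftCat G L) = d := by
        intro l d h
        -- Regularity provides an element of `I`, without which the ideal of `l` would be `{0}`.
        obtain ⟨i, -⟩ := hP.1 l
        have hm : Rees.mk i 1 l ∈ leftIdeal P d := h ▸ Or.inr ⟨i, 1, rfl⟩
        cases d with
        | zero => cases hm
        | pt k =>
          rcases hm with hm | ⟨j, a, hm⟩
          · cases hm
          · cases hm
            rfl
      cases c with
      | zero =>
        cases d with
        | zero => rfl
        | pt k => exact (key k _ h.symm).symm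
      | pt l => exact key l d h
    · rintro ⟨A, e, he, hA⟩
      rcases Rees.idempotent_cases he with rfl | ⟨i, l, p, hp, rfl⟩
      · exact ⟨.zero, LeftIdeals.ext (Rees.leftIdeal_zero.trans hA.symm)⟩
      · exact ⟨.pt l, LeftIdeals.ext ((Rees.leftIdeal_pt hp).trans hA.symm)⟩
  full := ⟨fun {c d} φ => by
    obtain ⟨e, u, f, he, hf, hc, hd, ⟨s, hs⟩, hu⟩ := φ.translation
    have hz : φ.toFun ⟨.zero, Rees.zero_mem_leftIdeal c⟩ =
        ⟨.zero, Rees.zero_mem_leftIdeal d⟩ := Subtype.ext (hu _)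
    have hmem : u ∈ leftIdeal P d := by
      rw [show leftIdeal P d = _ from hd]
      exact ⟨_, hs⟩
    -- Both maps send zero to zero, so only nonzero arguments have to be compared.
    suffices ∃ g : c ⟶ d, ∀ x (hx : x ∈ leftIdeal P c), x ≠ .zero →
        Rees.rightMul d (CUCat.label g) x = x * u by
      obtain ⟨g, hg⟩ := this
      refine ⟨g, LeftIdeals.Hom.ext (funext fun x => Subtype.ext ?_)⟩
      obtain ⟨x, hx⟩ := x
      by_cases h : x = .zero
      · subst h
        exact (congrArg Subtype.val hz).symm
      · exact (hg x hx h).trans (hu ⟨x, hx⟩).symm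
    cases c with
    | zero => exact ⟨⟨0, fun _ => rfl⟩, fun x hx h => absurd hx h⟩
    | pt l =>
      cases d with
      | zero =>
        obtain rfl : u = .zero := hmem
        exact ⟨⟨0, fun _ => rfl⟩, fun x _ _ => by
          rw [Rees.rightMul_zero_left, Rees.mul_zero']⟩
      | pt k =>
        rcases hmem with rfl | ⟨i, b, rfl⟩
        · refine ⟨⟨0, fun _ => rfl⟩, ?_⟩
          rintro x (rfl | ⟨j, a, rfl⟩) -
          · rfl
          · change Rees.mkZ P j (a * 0) k = .zero
            rw [mul_zero, Rees.mkZ_zero]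
        -- Right translation by `(i,b,k)` sends `(j,a,l)` to `(j, a p_{li} b, k)`, so its label is
        -- `p_{li} b`.
        · refine ⟨⟨P l i * b, by rintro (⟨⟨⟩⟩ | ⟨⟨⟩⟩)⟩, ?_⟩
          rintro x (rfl | ⟨j, a, rfl⟩) -
          · rfl
          · change Rees.mkZ P j (a * (P l i * b)) k = _
            rw [Rees.mk_mul_mk, mul_assoc]⟩
  faithful := ⟨fun {c d} φ ψ h => by
    apply CUCat.label_ext
    cases c with
    | zero => rw [CUCat.label_eq_zero φ (Or.inl rfl), CUCat.label_eq_zero ψ (Or.inl rfl)]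
    | pt l =>
      cases d with
      | zero => rw [CUCat.label_eq_zero φ (Or.inr rfl), CUCat.label_eq_zero ψ (Or.inr rfl)]
      | pt k =>
        obtain ⟨i, -⟩ := hP.1 l
        have h1 := congrArg Subtype.val (congrFun (congrArg LeftIdeals.Hom.toFun h)
          ⟨.mk i 1 l, Or.inr ⟨i, 1, rfl⟩⟩)
        have h2 : Rees.mkZ P i (((1 : G) : WithZero G) * CUCat.label φ) k =
          Rees.mkZ P i (((1 : G) : WithZero G) * CUCat.label ψ) k := h1
        simpa using Rees.mkZ_injective h2⟩
  incl_iff {c d} φ := by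
    rw [CUCat.isIncl_iff]
    constructor
    · intro h
      cases c with
      | zero => exact Or.inl rfl
      | pt l =>
        right
        obtain ⟨i, -⟩ := hP.1 l
        have h1 : Rees.rightMul d (CUCat.label φ) (.mk i 1 l : Rees P) = .mk i 1 l :=
          h ⟨.mk i 1 l, Or.inr ⟨i, 1, rfl⟩⟩
        cases d with
        | zero => cases h1
        | pt k =>
          change Rees.mkZ P i (((1 : G) : WithZero G) * CUCat.label φ) k = _ at h1
          rw [WithZero.coe_one, one_mul] at h1
          by_cases h0 : CUCat.label φ = 0
          · rw [h0, Rees.mkZ_zero] at h1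
            cases h1
          · obtain ⟨g, hg⟩ := WithZero.ne_zero_iff_exists.1 h0
            rw [← hg, Rees.mkZ_coe] at h1
            cases h1
            exact ⟨rfl, hg.symm⟩
    · rintro (rfl | ⟨rfl, h⟩)
      · rintro ⟨x, hx⟩
        obtain rfl : x = .zero := hx
        rfl
      · rintro ⟨x, hx⟩
        change Rees.rightMul c (CUCat.label φ) x = x
        rw [h]
        cases c with
        | zero => exact (Rees.rightMul_zero_left _ _).trans hx.symm
        | pt l =>
          rcases hx with rfl | ⟨i, a, rfl⟩
          · rfl
          · change Rees.mkZ P i (a * 1) l = _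
            rw [mul_one, Rees.mkZ_coe]

theorem isInclusionIso_rightCoordinates (hP : IsRegularSandwich P) :
    IsInclusionIso (rightCoordinates hP) where
  bijective := by
    constructor
    · intro c d h
      have h : rightIdeal P c = rightIdeal P d := congrArg RightIdeals.carrier h
      have key : ∀ (i : I) (d : RightCat G I), rightIdeal P (.pt i) = rightIdeal P d →
          (.pt i : RightCat G I) = d := by
        intro i d h
        obtain ⟨l, -⟩ := hP.2 i
        have hm : Rees.mk i 1 l ∈ rightIdeal P d := h ▸ Or.inr ⟨1, l, rfl⟩
        cases d with
        | zero => cases hm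
        | pt k =>
          rcases hm with hm | ⟨j, a, hm⟩
          · cases hm
          · cases hm
            rfl
      cases c with
      | zero =>
        cases d with
        | zero => rfl
        | pt k => exact (key k _ h.symm).symm
      | pt l => exact key l d h
    · rintro ⟨A, e, he, hA⟩
      rcases Rees.idempotent_cases he with rfl | ⟨i, l, p, hp, rfl⟩
      · exact ⟨.zero, RightIdeals.ext (Rees.rightIdeal_zero.trans hA.symm)⟩
      · exact ⟨.pt i, RightIdeals.ext ((Rees.rightIdeal_pt hp).trans hA.symm)⟩
  full := ⟨fun {c d} φ => by
    obtain ⟨e, u, f, he, hf, hc, hd, ⟨s, hs⟩, hu⟩ := φ.translation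
    have hz : φ.toFun ⟨.zero, Rees.zero_mem_rightIdeal c⟩ =
        ⟨.zero, Rees.zero_mem_rightIdeal d⟩ := Subtype.ext ((hu _).trans (Rees.mul_zero' u))
    have hmem : u ∈ rightIdeal P d := by
      rw [show rightIdeal P d = _ from hd]
      exact ⟨s * e, by rw [hs, mul_assoc]⟩
    suffices ∃ g : c ⟶ d, ∀ x (hx : x ∈ rightIdeal P c), x ≠ .zero →
        Rees.leftMul d (CUCat.label g).unop x = u * x by
      obtain ⟨g, hg⟩ := this
      refine ⟨g, RightIdeals.Hom.ext (funext fun x => Subtype.ext ?_)⟩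
      obtain ⟨x, hx⟩ := x
      by_cases h : x = .zero
      · subst h
        exact (congrArg Subtype.val hz).symm
      · exact (hg x hx h).trans (hu ⟨x, hx⟩).symm
    cases c with
    | zero => exact ⟨⟨0, fun _ => rfl⟩, fun x hx h => absurd hx h⟩
    | pt i =>
      cases d with
      | zero =>
        obtain rfl : u = .zero := hmem
        exact ⟨⟨0, fun _ => rfl⟩, fun x _ _ => by
          rw [Rees.leftMul_zero_left, Rees.zero_mul']⟩
      | pt j =>
        rcases hmem with rfl | ⟨b, l, rfl⟩
        · refine ⟨⟨0, fun _ => rfl⟩, ?_⟩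
          rintro x (rfl | ⟨a, k, rfl⟩) -
          · rfl
          · change Rees.mkZ P j (0 * a) k = .zero
            rw [zero_mul, Rees.mkZ_zero]
        -- Left translation by `(j,b,l)` inserts the entry `p_{li}` on the other side, so its label
        -- is the opposite of `b p_{li}`.
        · refine ⟨⟨op (b * P l i), by rintro (⟨⟨⟩⟩ | ⟨⟨⟩⟩)⟩, ?_⟩
          rintro x (rfl | ⟨a, k, rfl⟩) -
          · rfl
          · rfl⟩
  faithful := ⟨fun {c d} φ ψ h => by
    apply CUCat.label_ext
    cases c with
    | zero => rw [CUCat.label_eq_zero φ (Or.inl rfl), CUCat.label_eq_zero ψ (Or.inl rfl)]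
    | pt i =>
      cases d with
      | zero => rw [CUCat.label_eq_zero φ (Or.inr rfl), CUCat.label_eq_zero ψ (Or.inr rfl)]
      | pt j =>
        obtain ⟨l, -⟩ := hP.2 i
        have h1 := congrArg Subtype.val (congrFun (congrArg RightIdeals.Hom.toFun h)
          ⟨.mk i 1 l, Or.inr ⟨1, l, rfl⟩⟩)
        have h2 : Rees.mkZ P j ((CUCat.label φ).unop * ((1 : G) : WithZero G)) l =
          Rees.mkZ P j ((CUCat.label ψ).unop * ((1 : G) : WithZero G)) l := h1
        simpa using Rees.mkZ_injective h2⟩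
  incl_iff {c d} φ := by
    rw [CUCat.isIncl_iff]
    constructor
    · intro h
      cases c with
      | zero => exact Or.inl rfl
      | pt i =>
        right
        obtain ⟨l, -⟩ := hP.2 i
        have h1 : Rees.leftMul d (CUCat.label φ).unop (.mk i 1 l : Rees P) = .mk i 1 l :=
          h ⟨.mk i 1 l, Or.inr ⟨1, l, rfl⟩⟩
        cases d with
        | zero => cases h1
        | pt j =>
          change Rees.mkZ P j ((CUCat.label φ).unop * ((1 : G) : WithZero G)) l = _ at h1
          rw [WithZero.coe_one, mul_one] at h1
          by_cases h0 : (CUCat.label φ).unop = 0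
          · rw [h0, Rees.mkZ_zero] at h1
            cases h1
          · obtain ⟨g, hg⟩ := WithZero.ne_zero_iff_exists.1 h0
            rw [← hg, Rees.mkZ_coe] at h1
            cases h1
            exact ⟨rfl, unop_injective hg.symm⟩
    · rintro (rfl | ⟨rfl, h⟩)
      · rintro ⟨x, hx⟩
        obtain rfl : x = .zero := hx
        rfl
      · rintro ⟨x, hx⟩
        change Rees.leftMul c (CUCat.label φ).unop x = x
        rw [h]
        cases c with
        | zero => exact (Rees.leftMul_zero_left _ _).trans hx.symm
        | pt i =>
          rcases hx with rfl | ⟨a, l, rfl⟩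
          · rfl
          · change Rees.mkZ P i (1 * a) l = _
            rw [one_mul, Rees.mkZ_coe]

end Coordinates

/-! ## The main theorem -/

open Classical in
-- The category built from `G` and one index set does not involve the other set. To show it
-- completely unambiguous the other set may be taken equal to the first, with the identity matrix;
-- this also covers the empty set.
theorem exists_isRegularSandwich (G X : Type u) [Group G] :
    ∃ P : X → X → WithZero G, IsRegularSandwich P :=
  ⟨fun x y => if x = y then 1 else 0, fun x => ⟨x, by simp⟩, fun x => ⟨x, by simp⟩⟩

theorem isCompletelyUnambiguous_leftCat (G L : Type u) [Group G] :
    IsCompletelyUnambiguous (LeftCat G L) := by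
  obtain ⟨P, hP⟩ := exists_isRegularSandwich G L
  exact ⟨G, L, L, _, P, hP, Or.inl ⟨_, isInclusionIso_leftCoordinates hP⟩⟩

theorem isCompletelyUnambiguous_rightCat (G I : Type u) [Group G] :
    IsCompletelyUnambiguous (RightCat G I) := by
  obtain ⟨P, hP⟩ := exists_isRegularSandwich G I
  exact ⟨G, I, I, _, P, hP, Or.inr ⟨_, isInclusionIso_rightCoordinates hP⟩⟩

theorem mainTheorem5 {G I L : Type u} [Group G] :
    (∀ P : L → I → WithZero G, IsRegularSandwich P →
      ∃ (_ : IsUnambiguous (LeftIdeals (Rees P))) (_ : IsUnambiguous (RightIdeals (Rees P)))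
        (E : LeftCat G L ⥤ LeftIdeals (Rees P)) (E' : RightCat G I ⥤ RightIdeals (Rees P)),
        IsInclusionIso E ∧ IsLeftCoordinates P E ∧ IsInclusionIso E' ∧ IsRightCoordinates P E' ∧
        ∃! Ω : CrossConnection (LeftIdeals (Rees P)) (RightIdeals (Rees P)),
          Ω.IsOfSandwich P E E') ∧
    ∃ (_ : IsUnambiguous (LeftCat G L)) (_ : IsUnambiguous (RightCat G I)),
      IsCompletelyUnambiguous (LeftCat G L) ∧ IsCompletelyUnambiguous (RightCat G I) ∧
      ∀ P : L → I → WithZero G, IsRegularSandwich P →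
        ∃ Ω : CrossConnection (LeftCat G L) (RightCat G I),
          Ω.IsOfSandwich P (𝟭 _) (𝟭 _) ∧
          (∀ Ω' : CrossConnection (LeftCat G L) (RightCat G I),
            Ω'.IsOfSandwich P (𝟭 _) (𝟭 _) → Ω' = Ω) ∧
          ∃ T : Subsemigroup (NormalCone (LeftCat G L) × (NormalCone (RightCat G I))ᵐᵒᵖ),
            (T : Set _) = Ω.linkedPairs ∧ Nonempty (T ≃* Rees P) := by
  refine ⟨fun P hP => ?_, ?_⟩
  · have hE := isInclusionIso_leftCoordinates hP
    have hE' := isInclusionIso_rightCoordinates hP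
    have hL := hE.labelling.isUnambiguous
    have hR := hE'.labelling.isUnambiguous
    exact ⟨hL, hR, _, _, hE, isLeftCoordinates hP, hE', isRightCoordinates hP,
      CrossConnection.existsUnique_isOfSandwich hP hE hE'⟩
  -- The same existence and uniqueness result applies, with identity functors as coordinates.
  · have hE := IsInclusionIso.id_functor (LeftCat G L)
    have hE' := IsInclusionIso.id_functor (RightCat G I)
    have hL := hE.labelling.isUnambiguous
    have hR := hE'.labelling.isUnambiguous
    refine ⟨hL, hR, isCompletelyUnambiguous_leftCat G L, isCompletelyUnambiguous_rightCat G I,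
      fun P hP => ?_⟩
    obtain ⟨Ω, hΩ, huniq⟩ := CrossConnection.existsUnique_isOfSandwich hP hE hE'
    exact ⟨Ω, hΩ, huniq,
      ((CrossConnection.isOfSandwich_iff hE hE').1 hΩ).exists_linkedPairs_equiv hP⟩
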